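/- Let $\lambda$ be a limit ordinal and let $j\colon (V_\lambda,\in)\to(V_\lambda,\in)$ be an elementary embedding that is not the identity. For $f\colon V_\lambda\to V_\lambda$ and $A\subseteq V_\lambda$ write $f\cdot A=\bigcup_{\alpha<\lambda}f(A\cap V_\alpha)$. Assume that $j$ is $\Sigma^1_1$-elementary, i.e. for every formula $\varphi$ of the form $\exists X_1\cdots\exists X_q\,\psi$, where the $X_i$ are second-order variables (ranging over subsets of $V_\lambda$) and $\psi$ is a formula in the language $\{\in\}$ without second-order quantifiers, and for all $x_1,\dots,x_m\in V_\lambda$ and $A_1,\dots,A_p\subseteq V_\lambda$, $$V_\lambda\models\varphi[x_1,\dots,x_m,A_1,\dots,A_p]\iff V_\lambda\models\varphi[j(x_1),\dots,j(x_m),j\cdot A_1,\dots,j\cdot A_p].$$ Let $\kappa_0$ be the critical point of $j$ (the least ordinal $\kappa<\lambda$ with $\kappa<j(\kappa)$) and $\kappa_{i+1}=j(\kappa_i)$. Let $j^{(0)}=j$ and let $j^{(i+1)}=j^{(i)}j^{(i)}$ be the function whose graph, as a set of ordered pairs, is $j^{(i)}\cdot(\text{graph of }j^{(i)})$. Let $$k=j\circ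 j^{(1)}\circ j^{(2)}\circ\cdots\colon V_\lambda\to V_\lambda$$ be the function with $k(a)=(j^{(0)}\circ j^{(1)}\circ\cdots\circ j^{(N)})(a)$ for any $N$ such that $j^{(m)}(a)=a$ for all $m>N$. Then these objects are well defined: the sequence $\langle\kappa_i\mid i<\omega\rangle$ exists and is a strictly increasing sequence of ordinals below $\lambda$, every $j^{(i)}\cdot(\text{graph of }j^{(i)})$ is the graph of a function from $V_\lambda$ to $V_\lambda$, and for every $a\in V_\lambda$ there is an $N$ as required. Moreover, for every $n<\omega$, $$[\kappa_{2n},\kappa_{2n+1})\cap\mathrm{Def}^{V_\lambda}(\mathrm{rng}\,k\cup V_{\kappa_{2n}})=\emptyset,$$ where $[\kappa_{2n},\kappa_{2n+1})$ is an interval of ordinals and $\mathrm{Def}^{V_\lambda}(A)$ is the set of all $b\in V_\lambda$ such that for some first-order formula $\varphi(x,y_1,\dots,y_m)$ in the language $\{\in\}$ and some $a_1,\dots,a_m\in A$, $b$ is the unique element of $V_\lambda$ with $V_\lambda\models\varphi[b,a_1,\dots,a_m]$. -/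

import Mathlib

open scoped FirstOrder ZFSet

universe u

noncomputable section

namespace RankToRank

/-! ### The structure `(V_λ, ∈)` -/

/-- The underlying set of `V_λ`, as a type. -/
abbrev VSet (lam : Ordinal.{u}) : Type (u + 1) := {x : ZFSet.{u} // x ∈ V_ lam}

/-- The only relation symbol of the language of set theory: binary membership. -/
inductive SetRel : ℕ → Type
  | mem : SetRel 2

/-- The language `{∈}` of set theory. -/
def setLang : FirstOrder.Language.{0, 0} := ⟨fun _ => Empty, SetRel⟩

/-- `V_λ` as a structure for the language of set theory. -/
instance setStructure (lam : Ordinal.{u}) : setLang.Structure (VSet lam) where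
  funMap := fun f _ => nomatch f
  RelMap := fun r xs =>
    match r, xs with
    | SetRel.mem, xs => (xs 0).1 ∈ (xs 1).1

/-- The (von Neumann) ordinal `α < λ` as an element of `V_λ`. -/
def ordV {lam : Ordinal.{u}} (α : Ordinal.{u}) (h : α < lam) : VSet lam :=
  ⟨α.toZFSet, ZFSet.mem_vonNeumann.2 (by rwa [Ordinal.rank_toZFSet])⟩

/-! ### Extension of `f : V_λ → V_λ` to subsets of `V_λ`, and application -/

/-- `A ∩ V_α`, as an element of `V_λ`, for `A ⊆ V_λ` and `α < λ`. -/
def cut {lam : Ordinal.{u}} (A : Set (VSet lam)) (α : Set.Iio lam) : VSet lam :=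
  ⟨ZFSet.sep (fun x => ∃ h : x ∈ V_ lam, (⟨x, h⟩ : VSet lam) ∈ A) (V_ α.1),
    ZFSet.mem_vonNeumann.2 ((ZFSet.subset_vonNeumann.1 ZFSet.sep_subset).trans_lt α.2)⟩

/-- `f · A = ⋃_{α < λ} f (A ∩ V_α)` for `A ⊆ V_λ`. -/
def extend {lam : Ordinal.{u}} (f : VSet lam → VSet lam) (A : Set (VSet lam)) :
    Set (VSet lam) :=
  ⋃ α : Set.Iio lam, {y | y.1 ∈ (f (cut A α)).1}

/-- A function `g : V_λ → V_λ` encoded as the set of pairs `⟨x, g x⟩` (a subset of `V_λ`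
when `λ` is a limit ordinal). -/
def graphOf {lam : Ordinal.{u}} (g : VSet lam → VSet lam) : Set (VSet lam) :=
  {p | ∃ x, p.1 = ZFSet.pair x.1 (g x).1}

/-- The application `f g` of `f` to `g`: the function whose graph is `f · (graph of g)`. -/
def app {lam : Ordinal.{u}} (f g : VSet lam → VSet lam) : VSet lam → VSet lam :=
  fun x => @Classical.epsilon _ ⟨x⟩
    (fun y => ∃ p ∈ extend f (graphOf g), p.1 = ZFSet.pair x.1 y.1)

/-- The right powers `j^(0) = j`, `j^(n+1) = j^(n) j^(n)`. -/
def rightPower {lam : Ordinal.{u}} (j : VSet lam → VSet lam) : ℕ → VSet lam → VSet lam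
  | 0 => j
  | n + 1 => app (rightPower j n) (rightPower j n)

/-! ### Inverse limits -/

/-- `k₀ ∘ k₁ ∘ ⋯ ∘ kₙ`. -/
def compUpTo {X : Type*} (k : ℕ → X → X) : ℕ → X → X
  | 0 => k 0
  | n + 1 => compUpTo k n ∘ k (n + 1)

open Classical in
/-- The inverse limit `k₀ ∘ k₁ ∘ k₂ ∘ ⋯`, sending `a` to `(k₀ ∘ ⋯ ∘ kₙ) a`, where `n` is
such that `k_m a = a` for every `m > n` (the value does not depend on which such `n` is
taken; a point without such an `n` is left alone). -/
def inverseLimit {X : Type*} (k : ℕ → X → X) (a : X) : X :=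
  if h : ∃ n, ∀ m > n, k m a = a then compUpTo k (Nat.find h) a else a

/-! ### Critical sequence -/

open Classical in
/-- The action of `f : V_λ → V_λ` on ordinals below `λ`. For `f` elementary, `f α` is an
ordinal, hence equal to its rank. -/
def onOrd {lam : Ordinal.{u}} (f : VSet lam → VSet lam) (α : Ordinal.{u}) : Ordinal.{u} :=
  if h : α < lam then (f (ordV α h)).1.rank else α

/-- The critical point: the least ordinal `κ < λ` with `κ < f κ`. -/
def crit {lam : Ordinal.{u}} (f : VSet lam → VSet lam) : Ordinal.{u} :=
  sInf {α | α < lam ∧ α < onOrd f α}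

/-- The critical sequence: `κ₀ = crit f` and `κ_{n+1} = f κ_n`. -/
def critSeq {lam : Ordinal.{u}} (f : VSet lam → VSet lam) : ℕ → Ordinal.{u}
  | 0 => crit f
  | n + 1 => onOrd f (critSeq f n)

/-! ### `Σ¹₁`-elementarity -/

/-- Second-order variables, as unary predicate symbols indexed by `ι`. -/
inductive VarRel (ι : Type) : ℕ → Type
  | var (i : ι) : VarRel ι 1

/-- The language with a unary predicate symbol for each second-order variable `i : ι`. -/
def varLang (ι : Type) : FirstOrder.Language.{0, 0} := ⟨fun _ => Empty, VarRel ι⟩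

/-- The interpretation of second-order variables by subsets of `M`. -/
@[reducible]
def varStructure {ι : Type} {M : Type*} (A : ι → Set M) : (varLang ι).Structure M where
  funMap := fun f _ => nomatch f
  RelMap := fun r xs =>
    match r, xs with
    | VarRel.var i, xs => xs 0 ∈ A i

/-- Satisfaction in `V_λ`, at the first-order assignment `v` and second-order assignment
`A`, of a formula in the language `{∈}` without second-order quantifiers, whose first-order
variables are indexed by `α` and whose second-order variables are indexed by `ι`. -/
def Sat {lam : Ordinal.{u}} {ι α : Type} (φ : (setLang.sum (varLang ι)).Formula α)
    (A : ι → Set (VSet lam)) (v : α → VSet lam) : Prop :=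
  letI := varStructure A
  φ.Realize v

/-- Satisfaction in `V_λ` of the `Σ¹₁` formula `∃ X₁ ⋯ ∃ X_q φ`, with `p` free second-order
variables interpreted by `A` and `m` free first-order variables interpreted by `v`. -/
def SatSigma {lam : Ordinal.{u}} {p q m : ℕ}
    (φ : (setLang.sum (varLang (Fin p ⊕ Fin q))).Formula (Fin m))
    (A : Fin p → Set (VSet lam)) (v : Fin m → VSet lam) : Prop :=
  ∃ X : Fin q → Set (VSet lam), Sat φ (Sum.elim A X) v

/-- `f : V_λ → V_λ` preserves all `Σ¹₁` formulas, in both directions, with parameters that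
are elements `x` of `V_λ` (sent to `f x`) or subsets `A` of `V_λ` (sent to `f · A`). -/
def IsSigmaOneOne {lam : Ordinal.{u}} (f : VSet lam → VSet lam) : Prop :=
  ∀ (p q m : ℕ) (φ : (setLang.sum (varLang (Fin p ⊕ Fin q))).Formula (Fin m))
    (A : Fin p → Set (VSet lam)) (v : Fin m → VSet lam),
    SatSigma φ A v ↔ SatSigma φ (fun i => extend f (A i)) (fun i => f (v i))

/-! ### Definability -/

/-- `Def^{V_λ}(A)`: the elements of `V_λ` definable in `(V_λ, ∈)` by a first-order formula
with parameters from `A`. -/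
def defClosure {lam : Ordinal.{u}} (A : Set (VSet lam)) : Set (VSet lam) :=
  {b | A.Definable₁ setLang {b}}

/-- The interval `[α, β)` of ordinals, as a subset of `V_λ`. -/
def ordInterval (lam α β : Ordinal.{u}) : Set (VSet lam) :=
  {x | ∃ γ, α ≤ γ ∧ γ < β ∧ x.1 = γ.toZFSet}

/-- `V_α`, as a subset of `V_λ`. -/
def levelSet (lam α : Ordinal.{u}) : Set (VSet lam) := {x | x.1 ∈ V_ α}

end RankToRank

end

/-! Of the hypothesis on `j` only the case without second-order quantifiers is used: `j` preserves
first-order formulas with class parameters (`ClassElem`). So `j` can be applied to statements about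
functions on V_λ. From j^(i) · j^(m) = j^(m+1) it yields j^(i+1) · j^(m+1) = j^(m+2); hence the
equation holds for all i ≤ m, and j^(i) ∘ j^(m) = j^(m+1) ∘ j^(i) (`rightPower_comm`). In the same
way each j^(n) is elementary, fixes V_{κ_n} pointwise and sends κ_n to κ_{n+1}.

Write T_r = j^(2n) ∘ ⋯ ∘ j^(2n+r-1). Moving j^(0) ∘ ⋯ ∘ j^(n-1) to the right past j^(n) ∘ ⋯ ∘
j^(n+r-1) raises each index of the latter block by n and turns it into T_r. So every value of k lies
in the range of T_r for all large r, and so does every element of V_{κ_{2n}}, being fixed by T_r. By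
elementarity anything definable from such parameters is some T_r(x) (`exists_eq_of_mem_defClosure`).
For r > 0, T_r fixes the ordinals below κ_{2n} and sends κ_{2n} to κ_{2n+1}, so its range omits
[κ_{2n}, κ_{2n+1}).

That k is everywhere defined requires the κ_n to be cofinal in λ, which is Kunen's argument.
Otherwise j fixes V_η for η = sup κ_n < λ. As V_η has no more self-maps than ω-sequences, there is F
from ω-sequences in V_η to V_η taking all values on the sequences in the range of any injection
(`exists_jonsson`). Transferred to j · F and applied to j ↾ V_η, this gives t with (j · F)(j ∘ t) =
κ_0. But j ∘ t = j(t), so κ_0 is in the range of j, which is impossible. -/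

namespace RankToRank

/-! ### First-order formulas with named variables and class parameters -/

open FirstOrder FirstOrder.Language

/-- Formulas of the language `{∈}` with `p` second-order variables and named first-order
variables. -/
inductive Fml (p : ℕ) : Type
  | eq (a b : ℕ)
  | mem (a b : ℕ)
  | cls (i : Fin p) (a : ℕ)
  | neg (φ : Fml p)
  | and (φ ψ : Fml p)
  | ex (n : ℕ) (φ : Fml p)

namespace Fml

variable {lam : Ordinal.{u}} {p : ℕ}

/-- Satisfaction of a named formula in `V_λ`. -/
def Holds (A : Fin p → Set (VSet lam)) : Fml p → (ℕ → VSet lam) → Prop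
  | eq a b, v => v a = v b
  | mem a b, v => (v a).1 ∈ (v b).1
  | cls i a, v => v a ∈ A i
  | neg φ, v => ¬ φ.Holds A v
  | and φ ψ, v => φ.Holds A v ∧ ψ.Holds A v
  | ex n φ, v => ∃ x, φ.Holds A (Function.update v n x)

def or (φ ψ : Fml p) : Fml p := neg (and (neg φ) (neg ψ))
def imp (φ ψ : Fml p) : Fml p := neg (and φ (neg ψ))
def iff (φ ψ : Fml p) : Fml p := and (imp φ ψ) (imp ψ φ)
def all (n : ℕ) (φ : Fml p) : Fml p := neg (ex n (neg φ))

section Holds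

variable {A : Fin p → Set (VSet lam)} {φ ψ : Fml p} {v : ℕ → VSet lam}

@[simp] theorem holds_eq {a b : ℕ} : (eq a b).Holds A v ↔ v a = v b := Iff.rfl
@[simp] theorem holds_mem {a b : ℕ} : (mem a b).Holds A v ↔ (v a).1 ∈ (v b).1 := Iff.rfl
@[simp] theorem holds_cls {i : Fin p} {a : ℕ} : (cls i a).Holds A v ↔ v a ∈ A i := Iff.rfl
@[simp] theorem holds_neg : (neg φ).Holds A v ↔ ¬ φ.Holds A v := Iff.rfl
@[simp] theorem holds_and : (and φ ψ).Holds A v ↔ φ.Holds A v ∧ ψ.Holds A v := Iff.rfl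
@[simp] theorem holds_ex {n : ℕ} :
    (ex n φ).Holds A v ↔ ∃ x, φ.Holds A (Function.update v n x) := Iff.rfl
@[simp] theorem holds_or : (or φ ψ).Holds A v ↔ φ.Holds A v ∨ ψ.Holds A v := by
  simp only [or, holds_neg, holds_and]; tauto
@[simp] theorem holds_imp : (imp φ ψ).Holds A v ↔ (φ.Holds A v → ψ.Holds A v) := by
  simp only [imp, holds_neg, holds_and]; tauto
@[simp] theorem holds_iff : (iff φ ψ).Holds A v ↔ (φ.Holds A v ↔ ψ.Holds A v) := by
  simp only [iff, holds_and, holds_imp]; tauto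
@[simp] theorem holds_all {n : ℕ} :
    (all n φ).Holds A v ↔ ∀ x, φ.Holds A (Function.update v n x) := by
  simp [all]

end Holds

/-- A strict upper bound on the variables occurring in a formula. -/
def bound : Fml p → ℕ
  | eq a b => max a b + 1
  | mem a b => max a b + 1
  | cls _ a => a + 1
  | neg φ => φ.bound
  | and φ ψ => max φ.bound ψ.bound
  | ex n φ => max (n + 1) φ.bound

theorem holds_congr {A : Fin p → Set (VSet lam)} {φ : Fml p} {v w : ℕ → VSet lam}
    (h : ∀ i < φ.bound, v i = w i) : φ.Holds A v ↔ φ.Holds A w := by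
  induction φ generalizing v w with
  | eq a b => simp only [bound] at h; simp [h a (by lia), h b (by lia)]
  | mem a b => simp only [bound] at h; simp [h a (by lia), h b (by lia)]
  | cls i a => simp only [bound] at h; simp [h a (by lia)]
  | neg φ ih => simp [ih h]
  | and φ ψ ih₁ ih₂ =>
    simp only [bound] at h
    simp only [holds_and]
    rw [ih₁ fun i hi => h i (by lia), ih₂ fun i hi => h i (by lia)]
  | ex n φ ih =>
    simp only [bound] at h
    refine exists_congr fun x => ih fun i hi => ?_
    by_cases hin : i = n
    · simp [hin]
    · simp [hin, h i (by lia)]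

/-- Renaming all variables of a formula by `f`, reading every second-order variable as the
empty class. -/
def rename {q : ℕ} (f : ℕ → ℕ) : Fml p → Fml q
  | eq a b => eq (f a) (f b)
  | mem a b => mem (f a) (f b)
  | cls _ a => neg (eq (f a) (f a))
  | neg φ => neg (φ.rename f)
  | and φ ψ => and (φ.rename f) (ψ.rename f)
  | ex n φ => ex (f n) (φ.rename f)

/-- Bound variables are renamed too, so injectivity of `f` is what prevents capture. -/
theorem holds_rename {q : ℕ} {A : Fin q → Set (VSet lam)} {f : ℕ → ℕ} (hf : f.Injective)
    {φ : Fml p} {v : ℕ → VSet lam} :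
    (φ.rename f : Fml q).Holds A v ↔ φ.Holds (fun _ => ∅) (v ∘ f) := by
  induction φ generalizing v with
  | eq a b => simp [rename]
  | mem a b => simp [rename]
  | cls i a => simp [rename]
  | neg φ ih => simp [rename, ih]
  | and φ ψ ih₁ ih₂ => simp [rename, ih₁, ih₂]
  | ex n φ ih =>
    simp only [rename, holds_ex, ih]
    refine exists_congr fun x => ?_
    rw [Function.update_comp_eq_of_injective _ hf]

/-- Universal quantification over the first `n` variables. -/
def allBelow : ℕ → Fml p → Fml p
  | 0, φ => φ
  | n + 1, φ => allBelow n (all n φ)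

theorem holds_allBelow {A : Fin p → Set (VSet lam)} {n : ℕ} {φ : Fml p} {v : ℕ → VSet lam} :
    (allBelow n φ).Holds A v ↔ ∀ w, (∀ i, n ≤ i → w i = v i) → φ.Holds A w := by
  induction n generalizing φ with
  | zero =>
    refine ⟨fun h w hw => ?_, fun h => h v fun _ _ => rfl⟩
    rwa [show w = v from funext fun i => hw i (Nat.zero_le i)]
  | succ n ih =>
    simp only [allBelow, ih, holds_all]
    refine ⟨fun h w hw => ?_, fun h w hw x => h _ fun i hi => ?_⟩
    · have := h (Function.update w n (v n)) (fun i hi => ?_) (w n)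
      · simpa using this
      · by_cases hin : i = n
        · simp [hin]
        · simp [hin, hw i (by lia)]
    · rw [Function.update_of_ne (by lia), hw i (by lia)]

/-- Conjunction of the formulas `φ i` for `i < n`. -/
def andBelow (φ : ℕ → Fml p) : ℕ → Fml p
  | 0 => eq 0 0
  | n + 1 => and (andBelow φ n) (φ n)

theorem holds_andBelow {A : Fin p → Set (VSet lam)} {n : ℕ} {φ : ℕ → Fml p}
    {v : ℕ → VSet lam} : (andBelow φ n).Holds A v ↔ ∀ i < n, (φ i).Holds A v := by
  induction n with
  | zero => simp [andBelow]
  | succ n ih =>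
    rw [andBelow, holds_and, ih]
    refine ⟨fun h i hi => ?_, fun h => ⟨fun i hi => h i (by lia), h n (by lia)⟩⟩
    obtain rfl | hi := eq_or_lt_of_le (Nat.le_of_lt_succ hi)
    exacts [h.2, h.1 i hi]

/-- A named formula as a formula of Mathlib's model theory. -/
def toFormula : Fml p → (setLang.sum (varLang (Fin p ⊕ Fin 0))).Formula ℕ
  | eq a b => Term.equal (Term.var a) (Term.var b)
  | mem a b => Relations.formula₂ (Sum.inl SetRel.mem) (Term.var a) (Term.var b)
  | cls i a => Relations.formula₁ (Sum.inr (VarRel.var (Sum.inl i))) (Term.var a)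
  | neg φ => φ.toFormula.not
  | and φ ψ => φ.toFormula ⊓ ψ.toFormula
  | ex n φ => BoundedFormula.ex (n := 0)
      (BoundedFormula.relabel (n := 1) (k := 0)
        (fun m => if m = n then Sum.inr 0 else Sum.inl m) φ.toFormula)

theorem sat_toFormula {A : Fin p → Set (VSet lam)} {X : Fin 0 → Set (VSet lam)} {φ : Fml p}
    {v : ℕ → VSet lam} : Sat φ.toFormula (Sum.elim A X) v ↔ φ.Holds A v := by
  let _ := varStructure (Sum.elim A X)
  change φ.toFormula.Realize v ↔ _
  induction φ generalizing v with
  | eq a b => simp [toFormula]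
  | mem a b => exact Iff.rfl
  | cls i a => exact Iff.rfl
  | neg φ ih => simp [toFormula, ih]
  | and φ ψ ih₁ ih₂ => simp [toFormula, ih₁, ih₂]
  | ex n φ ih =>
    simp only [toFormula, Formula.Realize, BoundedFormula.realize_ex,
      BoundedFormula.realize_relabel, holds_ex]
    refine exists_congr fun x => ?_
    rw [← ih, Formula.Realize, iff_iff_eq]
    congr 1
    · ext m
      by_cases hm : m = n
      · subst hm; simp [Fin.snoc]
      · simp [hm]
    · exact Subsingleton.elim _ _

/-- A first-order formula in the language `{∈}` as a named formula: the free variable `i : Fin m`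
is named `i` and the bound variable `k` is named `m + k`. -/
def ofBounded {m : ℕ} : ∀ {n : ℕ}, setLang.BoundedFormula (Fin m) n → Fml 0
  | _, .falsum => neg (eq 0 0)
  | _, .equal t₁ t₂ => eq (name t₁) (name t₂)
  | _, .rel R ts => match R, ts with
    | SetRel.mem, ts => mem (name (ts 0)) (name (ts 1))
  | _, .imp φ ψ => imp (ofBounded φ) (ofBounded ψ)
  | n, .all φ => all (m + n) (ofBounded φ)
where
  name {n : ℕ} : setLang.Term (Fin m ⊕ Fin n) → ℕ
    | .var (Sum.inl i) => i
    | .var (Sum.inr k) => m + k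
    | .func f _ => nomatch f

theorem name_spec {m n : ℕ} (t : setLang.Term (Fin m ⊕ Fin n)) (v : ℕ → VSet lam) :
    v (ofBounded.name t) =
      t.realize (Sum.elim (fun i : Fin m => v i) fun k : Fin n => v (m + k)) := by
  match t with
  | .var (Sum.inl i) => rfl
  | .var (Sum.inr k) => rfl
  | .func f _ => exact nomatch f

theorem holds_ofBounded {m n : ℕ} {A : Fin 0 → Set (VSet lam)}
    (φ : setLang.BoundedFormula (Fin m) n) (v : ℕ → VSet lam) :
    (ofBounded φ).Holds A v ↔
      φ.Realize (fun i : Fin m => v i) fun k : Fin n => v (m + k) := by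
  induction φ generalizing v with
  | falsum => simp [ofBounded, BoundedFormula.Realize]
  | equal t₁ t₂ => simp [ofBounded, BoundedFormula.Realize, name_spec]
  | rel R ts =>
    cases R
    simp only [ofBounded, holds_mem, name_spec]
    exact Iff.rfl
  | imp φ ψ ih₁ ih₂ => simp [ofBounded, ih₁, ih₂]
  | @all n φ ih =>
    simp only [ofBounded, holds_all, ih, BoundedFormula.realize_all]
    refine forall_congr' fun x => ?_
    rw [iff_iff_eq]
    congr 1
    · ext i
      rw [Function.update_of_ne (by lia)]
    · ext k
      refine Fin.lastCases ?_ (fun k => ?_) k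
      · simp
      · simp [Fin.snoc_castSucc, Function.update_of_ne (show m + (k : ℕ) ≠ m + n by lia)]

end Fml

variable {lam : Ordinal.{u}}

/-! ### Closure properties of `V_λ` -/

/-- An element of an element of `V_λ`, as an element of `V_λ`. -/
def ofMem {y : ZFSet.{u}} (x : VSet lam) (h : y ∈ x.1) : VSet lam :=
  ⟨y, (ZFSet.isTransitive_vonNeumann lam).subset_of_mem x.2 h⟩

theorem VSet.ext_mem {x y : VSet lam} (h : ∀ z : VSet lam, z.1 ∈ x.1 ↔ z.1 ∈ y.1) : x = y :=
  Subtype.ext <| ZFSet.ext fun _ =>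
    ⟨fun hz => (h (ofMem x hz)).1 hz, fun hz => (h (ofMem y hz)).2 hz⟩

theorem VSet.subset_iff {x y : VSet lam} :
    x.1 ⊆ y.1 ↔ ∀ z : VSet lam, z.1 ∈ x.1 → z.1 ∈ y.1 :=
  ⟨fun h _ hz => h hz, fun h _ hz => h (ofMem x hz) hz⟩

theorem insert_mem_vonNeumann (hlam : Order.IsSuccLimit lam) {x y : ZFSet.{u}} (hx : x ∈ V_ lam)
    (hy : y ∈ V_ lam) : insert x y ∈ V_ lam := by
  rw [ZFSet.mem_vonNeumann] at *
  rw [ZFSet.rank_insert]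
  exact max_lt (hlam.succ_lt hx) hy

theorem singleton_mem_vonNeumann (hlam : Order.IsSuccLimit lam) {x : ZFSet.{u}}
    (hx : x ∈ V_ lam) : {x} ∈ V_ lam := by
  rw [ZFSet.mem_vonNeumann] at *
  rw [ZFSet.rank_singleton]
  exact hlam.succ_lt hx

theorem pair_mem_vonNeumann (hlam : Order.IsSuccLimit lam) {x y : ZFSet.{u}} (hx : x ∈ V_ lam)
    (hy : y ∈ V_ lam) : ZFSet.pair x y ∈ V_ lam :=
  insert_mem_vonNeumann hlam (singleton_mem_vonNeumann hlam hx)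
    (singleton_mem_vonNeumann hlam
      (insert_mem_vonNeumann hlam hx (singleton_mem_vonNeumann hlam hy)))

/-- The ordered pair of two elements of `V_λ`. -/
def pairV (hlam : Order.IsSuccLimit lam) (x y : VSet lam) : VSet lam :=
  ⟨ZFSet.pair x.1 y.1, pair_mem_vonNeumann hlam x.2 y.2⟩

/-! ### Some formulas -/

namespace Fml

variable {p : ℕ} {A : Fin p → Set (VSet lam)} {v : ℕ → VSet lam}

/-- `a ⊆ b` -/
def sub (a b : ℕ) : Fml p := all (a + b + 1) (imp (mem (a + b + 1) a) (mem (a + b + 1) b))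

-- The quantified name `a + b + 1` is fresh, and quantifying over V_λ loses nothing because V_λ is
-- transitive. The formulas below follow the same pattern.
@[simp] theorem holds_sub {a b : ℕ} : (sub a b).Holds A v ↔ (v a).1 ⊆ (v b).1 := by
  simp only [sub, holds_all, holds_imp, holds_mem, Function.update_self,
    Function.update_of_ne (show a ≠ a + b + 1 by lia),
    Function.update_of_ne (show b ≠ a + b + 1 by lia)]
  exact VSet.subset_iff.symm

/-- `a = {b, c}` -/
def isUpair (a b c : ℕ) : Fml p :=
  all (a + b + c + 1) (iff (mem (a + b + c + 1) a)
    (or (eq (a + b + c + 1) b) (eq (a + b + c + 1) c)))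

@[simp] theorem holds_isUpair {a b c : ℕ} :
    (isUpair a b c).Holds A v ↔ (v a).1 = {(v b).1, (v c).1} := by
  simp only [isUpair, holds_all, holds_iff, holds_or, holds_eq, holds_mem, Function.update_self,
    Function.update_of_ne (show a ≠ a + b + c + 1 by lia),
    Function.update_of_ne (show b ≠ a + b + c + 1 by lia),
    Function.update_of_ne (show c ≠ a + b + c + 1 by lia)]
  constructor
  · intro h
    ext z
    rw [ZFSet.mem_pair]
    constructor
    · exact fun hz => ((h (ofMem (v a) hz)).1 hz).imp (congrArg Subtype.val)
        (congrArg Subtype.val)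
    · rintro (rfl | rfl)
      · exact (h (v b)).2 (Or.inl rfl)
      · exact (h (v c)).2 (Or.inr rfl)
  · intro h x
    rw [h, ZFSet.mem_pair, Subtype.ext_iff, Subtype.ext_iff]

/-- `q` is the ordered pair `(a, b)` -/
def isPair (q a b : ℕ) : Fml p :=
  ex (q + a + b + 1) (ex (q + a + b + 2) (and (isUpair (q + a + b + 1) a a)
    (and (isUpair (q + a + b + 2) a b) (isUpair q (q + a + b + 1) (q + a + b + 2)))))

@[simp] theorem holds_isPair {q a b : ℕ} :
    (isPair q a b).Holds A v ↔ (v q).1 = ZFSet.pair (v a).1 (v b).1 := by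
  simp only [isPair, holds_ex, holds_and, holds_isUpair, Function.update_self,
    Function.update_of_ne (show a ≠ q + a + b + 1 by lia),
    Function.update_of_ne (show b ≠ q + a + b + 1 by lia),
    Function.update_of_ne (show q ≠ q + a + b + 1 by lia),
    Function.update_of_ne (show a ≠ q + a + b + 2 by lia),
    Function.update_of_ne (show b ≠ q + a + b + 2 by lia),
    Function.update_of_ne (show q ≠ q + a + b + 2 by lia),
    Function.update_of_ne (show q + a + b + 1 ≠ q + a + b + 2 by lia)]
  constructor
  · rintro ⟨s, d, hs, hd, hq⟩
    rw [hq, hs, hd, ZFSet.pair_eq_singleton, ZFSet.pair]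
  · intro h
    refine ⟨ofMem (v q) (y := {(v a).1}) ?_, ofMem (v q) (y := {(v a).1, (v b).1}) ?_, ?_, rfl, h⟩
    · rw [h, ZFSet.pair, ZFSet.mem_pair]; exact Or.inl rfl
    · rw [h, ZFSet.pair, ZFSet.mem_pair]; exact Or.inr rfl
    · rw [ZFSet.pair_eq_singleton]; rfl

/-- The pair `(a, b)` belongs to the class `i` -/
def pairCls (i : Fin p) (a b : ℕ) : Fml p :=
  ex (a + b + 1) (and (isPair (a + b + 1) a b) (cls i (a + b + 1)))

@[simp] theorem holds_pairCls {i : Fin p} {a b : ℕ} :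
    (pairCls i a b).Holds A v ↔ ∃ q ∈ A i, q.1 = ZFSet.pair (v a).1 (v b).1 := by
  simp only [pairCls, holds_ex, holds_and, holds_isPair, holds_cls, Function.update_self,
    Function.update_of_ne (show a ≠ a + b + 1 by lia),
    Function.update_of_ne (show b ≠ a + b + 1 by lia), and_comm]

/-- The pair `(a, b)` belongs to the set `s` -/
def pairMem (a b s : ℕ) : Fml p :=
  ex (a + b + s + 1) (and (isPair (a + b + s + 1) a b) (mem (a + b + s + 1) s))

@[simp] theorem holds_pairMem {a b s : ℕ} :
    (pairMem a b s).Holds A v ↔ ZFSet.pair (v a).1 (v b).1 ∈ (v s).1 := by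
  simp only [pairMem, holds_ex, holds_and, holds_isPair, holds_mem, Function.update_self,
    Function.update_of_ne (show a ≠ a + b + s + 1 by lia),
    Function.update_of_ne (show b ≠ a + b + s + 1 by lia),
    Function.update_of_ne (show s ≠ a + b + s + 1 by lia)]
  constructor
  · rintro ⟨x, hx, h⟩
    rwa [← hx]
  · exact fun h => ⟨ofMem (v s) h, rfl, h⟩

end Fml

/-! ### Elementary maps -/

/-- `f` is elementary for named formulas. -/
def Elem (f : VSet lam → VSet lam) : Prop :=
  ∀ (φ : Fml 0) (v : ℕ → VSet lam),
    φ.Holds (fun _ => ∅) v ↔ φ.Holds (fun _ => ∅) (f ∘ v)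

/-- `j` is elementary for named formulas with second-order parameters. -/
def ClassElem (j : VSet lam → VSet lam) : Prop :=
  ∀ (p : ℕ) (φ : Fml p) (A : Fin p → Set (VSet lam)) (v : ℕ → VSet lam),
    φ.Holds A v ↔ φ.Holds (fun i => extend j (A i)) (j ∘ v)

theorem IsSigmaOneOne.classElem {j : VSet lam → VSet lam} (hj : IsSigmaOneOne j) :
    ClassElem j := by
  intro p φ A v
  let m := φ.bound
  -- Only names below `m` occur, so reduction modulo `m + 1` changes none of them.
  let ψ := φ.toFormula.relabel (Fin.ofNat (m + 1))
  have key (B : Fin p → Set (VSet lam)) (w : ℕ → VSet lam) :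
      SatSigma (q := 0) ψ B (fun i => w i) ↔ φ.Holds B w := by
    have (X : Fin 0 → Set (VSet lam)) : Sat ψ (Sum.elim B X) (fun i => w i) ↔ φ.Holds B w := by
      let _ := varStructure (Sum.elim B X)
      change ψ.Realize _ ↔ _
      rw [Formula.realize_relabel]
      refine Fml.sat_toFormula.trans (Fml.holds_congr fun i hi => ?_)
      have : i % (m + 1) = i := Nat.mod_eq_of_lt (by lia)
      simp [this]
    exact ⟨fun ⟨X, h⟩ => (this X).1 h, fun h => ⟨fun _ => ∅, (this _).2 h⟩⟩
  rw [← key, ← key]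
  exact hj p 0 _ ψ A _

theorem ClassElem.elem {j : VSet lam → VSet lam} (hj : ClassElem j) : Elem j := by
  intro φ v
  rw [hj 0 φ]
  rw [show (fun i : Fin 0 => extend j ∅) = fun _ => ∅ from Subsingleton.elim _ _]

namespace Elem

variable {f g : VSet lam → VSet lam}

/-- An elementary map as an elementary embedding in the sense of Mathlib. -/
def toElementaryEmbedding (hf : Elem f) : VSet lam ↪ₑ[setLang] VSet lam where
  toFun := f
  map_formula' m φ x := by
    -- A default element `d` is needed to extend a finite assignment to all names.
    obtain hE | ⟨⟨d⟩⟩ := isEmpty_or_nonempty (VSet lam)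
    · cases m with
      | zero => rw [Subsingleton.elim (f ∘ x) x]
      | succ m => exact hE.elim (x 0)
    · let v : ℕ → VSet lam := fun i => if h : i < m then x ⟨i, h⟩ else d
      have h₁ := Fml.holds_ofBounded (A := fun _ => ∅) φ v
      have h₂ := Fml.holds_ofBounded (A := fun _ => ∅) φ (f ∘ v)
      rw [← hf, h₁] at h₂
      have hv : (fun i : Fin m => v i) = x := by ext i; simp [v]
      have hv' : (fun i : Fin m => (f ∘ v) i) = f ∘ x := by ext i; simp [v]
      rw [hv, hv'] at h₂
      rw [Formula.Realize, Formula.Realize]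
      convert h₂.symm

theorem comp (hf : Elem f) (hg : Elem g) : Elem (f ∘ g) := fun φ v => by
  rw [hg, hf]; rfl

theorem mem_iff (hf : Elem f) (x y : VSet lam) : (f x).1 ∈ (f y).1 ↔ x.1 ∈ y.1 :=
  (hf (.mem 0 1) fun i => if i = 0 then x else y).symm

theorem injective (hf : Elem f) : Function.Injective f := fun x y h =>
  (hf (.eq 0 1) fun i => if i = 0 then x else y).2 h

theorem subset_iff (hf : Elem f) (x y : VSet lam) : (f x).1 ⊆ (f y).1 ↔ x.1 ⊆ y.1 := by
  simpa using (hf (.sub 0 1) fun i => if i = 0 then x else y).symm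

theorem pair_iff (hf : Elem f) (q x y : VSet lam) :
    (f q).1 = ZFSet.pair (f x).1 (f y).1 ↔ q.1 = ZFSet.pair x.1 y.1 := by
  simpa using (hf (.isPair 0 1 2) fun i => if i = 0 then q else if i = 1 then x else y).symm

theorem pair_mem_iff (hf : Elem f) (x y s : VSet lam) :
    ZFSet.pair (f x).1 (f y).1 ∈ (f s).1 ↔ ZFSet.pair x.1 y.1 ∈ s.1 := by
  simpa using (hf (.pairMem 0 1 2) fun i => if i = 0 then x else if i = 1 then y else s).symm

end Elem

/-! ### Extension to classes -/

/-- Any set c ⊆ A lies in a cut of A, and `f` preserves inclusion. Unlike the definition by cuts,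
this form is visibly first-order in `f` and `A`. -/
theorem mem_extend {f : VSet lam → VSet lam} (hf : Elem f)
    {A : Set (VSet lam)} {y : VSet lam} :
    y ∈ extend f A ↔ ∃ c : VSet lam, (∀ z : VSet lam, z.1 ∈ c.1 → z ∈ A) ∧ y.1 ∈ (f c).1 := by
  simp only [extend, Set.mem_iUnion]
  constructor
  · rintro ⟨α, hα⟩
    refine ⟨cut A α, fun z hz => ?_, hα⟩
    rw [cut, ZFSet.mem_sep] at hz
    exact hz.2.2
  · rintro ⟨c, hc, hy⟩
    refine ⟨⟨c.1.rank, ZFSet.mem_vonNeumann.1 c.2⟩, ?_⟩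
    refine (hf.subset_iff c (cut A _)).2 (fun z hz => ?_) hy
    rw [cut, ZFSet.mem_sep]
    exact ⟨ZFSet.subset_vonNeumann_self _ hz, (ofMem c hz).2, hc (ofMem c hz) hz⟩

theorem mem_graphOf_iff {g : VSet lam → VSet lam} {q x y : VSet lam}
    (hq : q.1 = ZFSet.pair x.1 y.1) : q ∈ graphOf g ↔ g x = y := by
  constructor
  · rintro ⟨z, hz⟩
    rw [hq, ZFSet.pair_inj] at hz
    rw [Subtype.ext hz.1, Subtype.ext hz.2]
  · rintro rfl
    exact ⟨x, hq⟩

theorem exists_pair_mem_graphOf_iff (hlam : Order.IsSuccLimit lam) {g : VSet lam → VSet lam}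
    {x y : VSet lam} : (∃ q ∈ graphOf g, q.1 = ZFSet.pair x.1 y.1) ↔ g x = y :=
  ⟨fun ⟨_, hq, h⟩ => (mem_graphOf_iff h).1 hq,
    fun h => ⟨pairV hlam x y, (mem_graphOf_iff rfl).2 h, rfl⟩⟩

theorem graphOf_injective (hlam : Order.IsSuccLimit lam) :
    Function.Injective (graphOf : (VSet lam → VSet lam) → Set (VSet lam)) := by
  intro g h hgh
  ext1 x
  rw [eq_comm, ← exists_pair_mem_graphOf_iff hlam, ← hgh, exists_pair_mem_graphOf_iff hlam]

/-- Once the extension is known to be a graph, the choice made in `app` has only one possible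
outcome. -/
theorem app_eq (hlam : Order.IsSuccLimit lam) {f g h : VSet lam → VSet lam}
    (H : extend f (graphOf g) = graphOf h) : app f g = h := by
  ext1 x
  have := Classical.epsilon_spec (p := fun y : VSet lam =>
    ∃ p ∈ graphOf h, p.1 = ZFSet.pair x.1 y.1) ⟨h x, (exists_pair_mem_graphOf_iff hlam).2 rfl⟩
  rw [app, H]
  exact ((exists_pair_mem_graphOf_iff hlam).1 this).symm

namespace Fml

variable {p : ℕ} {A : Fin p → Set (VSet lam)} {v : ℕ → VSet lam}

/-- The class `i` is the graph of a function. -/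
def isGraph (i : Fin p) : Fml p :=
  and (all 0 (imp (cls i 0) (ex 1 (ex 2 (isPair 0 1 2)))))
    (all 0 (ex 1 (and (pairCls i 0 1) (all 2 (imp (pairCls i 0 2) (eq 2 1))))))

theorem holds_isGraph (hlam : Order.IsSuccLimit lam) {i : Fin p} :
    (isGraph i).Holds A v ↔ ∃ g, A i = graphOf g := by
  simp only [isGraph, holds_and, holds_all, holds_imp, holds_ex, holds_cls, holds_isPair,
    holds_pairCls, holds_eq]
  simp only [Function.update_self, ne_eq, OfNat.zero_ne_ofNat, zero_ne_one, OfNat.one_ne_ofNat,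
    not_false_eq_true, Function.update_of_ne]
  constructor
  · rintro ⟨h₁, h₂⟩
    choose g hg hg' using h₂
    refine ⟨g, Set.ext fun q => ⟨fun hq => ?_, ?_⟩⟩
    · obtain ⟨x, y, hxy⟩ := h₁ q hq
      exact (mem_graphOf_iff hxy).2 (hg' x y ⟨q, hq, hxy⟩).symm
    · rintro ⟨x, hx⟩
      obtain ⟨q', hq', h⟩ := hg x
      rwa [Subtype.ext (hx.trans h.symm)]
  · rintro ⟨g, hg⟩
    rw [hg]
    refine ⟨fun q ⟨x, hx⟩ => ⟨x, g x, hx⟩, fun x => ⟨g x, ?_, fun y hy => ?_⟩⟩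
    · exact (exists_pair_mem_graphOf_iff hlam).2 rfl
    · exact ((exists_pair_mem_graphOf_iff hlam).1 hy).symm

/-- The class `2` is the extension of the function with graph `0` to the class `1`. -/
def isExtend : Fml 3 :=
  all 0 (iff (cls 2 0) (ex 1 (ex 2 (and (all 3 (imp (mem 3 1) (cls 1 3)))
    (and (pairCls 0 1 2) (mem 0 2))))))

theorem holds_isExtend (hlam : Order.IsSuccLimit lam) {f : VSet lam → VSet lam} (hf : Elem f)
    {B C : Set (VSet lam)} : isExtend.Holds ![graphOf f, B, C] v ↔ extend f B = C := by
  simp only [isExtend, holds_and, holds_all, holds_imp, holds_ex, holds_cls, holds_iff,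
    holds_mem, holds_pairCls, Matrix.cons_val, exists_pair_mem_graphOf_iff hlam]
  simp only [Function.update_self, ne_eq, OfNat.zero_ne_ofNat, zero_ne_one,
    OfNat.one_ne_ofNat, not_false_eq_true, Function.update_of_ne]
  rw [Set.ext_iff]
  refine forall_congr' fun y => ?_
  rw [iff_comm (a := y ∈ C)]
  refine iff_congr (Iff.symm ?_) Iff.rfl
  rw [mem_extend hf]
  refine exists_congr fun c => ⟨fun ⟨h, h'⟩ => ⟨f c, h, rfl, h'⟩, ?_⟩
  rintro ⟨_, h, rfl, h'⟩
  exact ⟨h, h'⟩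

/-- The function whose graph is the class `0` preserves `φ`. -/
def preserves (φ : Fml 0) : Fml 1 :=
  allBelow (2 * φ.bound) (imp (andBelow (fun i => pairCls 0 i (i + φ.bound)) φ.bound)
    (iff (φ.rename id) (φ.rename (· + φ.bound))))

/-- Elementarity of a class function is a scheme, one formula for each `φ`: names below `φ.bound`
carry the arguments, and shifting by `φ.bound` gives the names of their images. -/
theorem holds_preserves (hlam : Order.IsSuccLimit lam) {f : VSet lam → VSet lam} {φ : Fml 0} :
    (preserves φ).Holds (fun _ => graphOf f) v ↔
      ∀ w, φ.Holds (fun _ => ∅) w ↔ φ.Holds (fun _ => ∅) (f ∘ w) := by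
  simp only [preserves, holds_allBelow, holds_imp, holds_andBelow, holds_pairCls, holds_iff,
    exists_pair_mem_graphOf_iff hlam, holds_rename Function.injective_id,
    holds_rename (add_left_injective φ.bound), Function.comp_id]
  constructor
  · intro h w
    have := h (fun i => if i < φ.bound then w i else
      if i < 2 * φ.bound then f (w (i - φ.bound)) else v i) (fun i hi => ?_) (fun i hi => ?_)
    · refine Iff.trans (holds_congr fun i hi => ?_) (this.trans (holds_congr fun i hi => ?_))
      · simp [hi]
      · simp [show i + φ.bound < 2 * φ.bound by lia]
    · simp [show ¬ i < φ.bound by lia, show ¬ i < 2 * φ.bound by lia]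
    · simp [hi, show i + φ.bound < 2 * φ.bound by lia]
  · intro h w _ hw
    rw [h w]
    exact holds_congr fun i hi => hw i hi

end Fml

/-! ### Applying `j` to statements about class functions -/

namespace ClassElem

variable {j : VSet lam → VSet lam}

theorem exists_extend_eq_graphOf (hlam : Order.IsSuccLimit lam) (hj : ClassElem j)
    (g : VSet lam → VSet lam) : ∃ h, extend j (graphOf g) = graphOf h := by
  have d : VSet lam := ⟨∅, ZFSet.mem_vonNeumann.2 (by simpa using hlam.bot_lt)⟩
  have := hj 1 (.isGraph 0) (fun _ => graphOf g) fun _ => d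
  rw [Fml.holds_isGraph hlam, Fml.holds_isGraph hlam] at this
  exact this.1 ⟨g, rfl⟩

/-- The equation f · B = C is first-order in the three classes, so `j` carries it to (j · f) · (j ·
B) = j · C. -/
theorem extend_extend (hlam : Order.IsSuccLimit lam) (hj : ClassElem j)
    {f f' : VSet lam → VSet lam} (hf : Elem f) (hf' : Elem f')
    (hff' : extend j (graphOf f) = graphOf f') {B C : Set (VSet lam)} (h : extend f B = C) :
    extend f' (extend j B) = extend j C := by
  have d : VSet lam := ⟨∅, ZFSet.mem_vonNeumann.2 (by simpa using hlam.bot_lt)⟩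
  have := hj 3 .isExtend ![graphOf f, B, C] fun _ => d
  rw [Fml.holds_isExtend hlam hf, show (fun i => extend j (![graphOf f, B, C] i)) =
    ![graphOf f', extend j B, extend j C] by
      ext1 i; fin_cases i <;> simp [hff'], Fml.holds_isExtend hlam hf'] at this
  exact this.1 h

theorem elem_of_extend (hlam : Order.IsSuccLimit lam) (hj : ClassElem j)
    {f f' : VSet lam → VSet lam} (hf : Elem f) (hff' : extend j (graphOf f) = graphOf f') :
    Elem f' := by
  intro φ
  have d : VSet lam := ⟨∅, ZFSet.mem_vonNeumann.2 (by simpa using hlam.bot_lt)⟩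
  have := hj 1 (.preserves φ) (fun _ => graphOf f) fun _ => d
  rw [hff', Fml.holds_preserves hlam, Fml.holds_preserves hlam] at this
  exact this.1 (hf φ)

end ClassElem

/-! ### The right powers -/

section RightPower

variable {j : VSet lam → VSet lam}

/-- The three claims need a joint induction: applying `j` to j^(n) · j^(n) = j^(n+1) gives j^(n+1) ·
j^(n+1) = j · j^(n+1), and the right side is known to be a graph. -/
theorem rightPower_spec (hlam : Order.IsSuccLimit lam) (hj : ClassElem j) (n : ℕ) :
    extend j (graphOf (rightPower j n)) = graphOf (rightPower j (n + 1)) ∧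
    extend (rightPower j n) (graphOf (rightPower j n)) = graphOf (rightPower j (n + 1)) ∧
    Elem (rightPower j n) := by
  induction n with
  | zero =>
    obtain ⟨h, hh⟩ := hj.exists_extend_eq_graphOf hlam j
    have : rightPower j 1 = h := app_eq hlam hh
    rw [zero_add, this]
    exact ⟨hh, hh, hj.elem⟩
  | succ n ih =>
    obtain ⟨ih₁, ih₂, ih₃⟩ := ih
    have hE := hj.elem_of_extend hlam ih₃ ih₁
    have h' := hj.extend_extend hlam ih₃ hE ih₁ ih₂
    obtain ⟨h, hh⟩ := hj.exists_extend_eq_graphOf hlam (rightPower j (n + 1))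
    rw [ih₁, hh] at h'
    have : rightPower j (n + 1 + 1) = h := app_eq hlam h'
    rw [this]
    exact ⟨hh, h', hE⟩

theorem elem_rightPower (hlam : Order.IsSuccLimit lam) (hj : ClassElem j) (n : ℕ) :
    Elem (rightPower j n) := (rightPower_spec hlam hj n).2.2

theorem extend_rightPower (hlam : Order.IsSuccLimit lam) (hj : ClassElem j) {i m : ℕ}
    (him : i ≤ m) :
    extend (rightPower j i) (graphOf (rightPower j m)) = graphOf (rightPower j (m + 1)) := by
  induction i generalizing m with
  | zero => exact (rightPower_spec hlam hj m).1
  | succ i ih =>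
    obtain ⟨m, rfl⟩ : ∃ k, m = k + 1 := ⟨m - 1, by lia⟩
    have := hj.extend_extend hlam (elem_rightPower hlam hj i) (elem_rightPower hlam hj (i + 1))
      (rightPower_spec hlam hj i).1 (ih (m := m) (by lia))
    rwa [(rightPower_spec hlam hj m).1, (rightPower_spec hlam hj (m + 1)).1] at this

/-- The pair (x, g x) is in the graph of `g`, so its image (f x, f (g x)) is in f · g. -/
theorem apply_apply_of_extend (hlam : Order.IsSuccLimit lam) {f g h : VSet lam → VSet lam}
    (hf : Elem f) (H : extend f (graphOf g) = graphOf h) (x : VSet lam) :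
    f (g x) = h (f x) := by
  have hq : f (pairV hlam x (g x)) ∈ extend f (graphOf g) := by
    refine (mem_extend hf).2 ⟨⟨{(pairV hlam x (g x)).1},
      singleton_mem_vonNeumann hlam (pairV hlam x (g x)).2⟩, fun z hz => ?_, ?_⟩
    · rw [ZFSet.mem_singleton] at hz
      exact ⟨x, hz⟩
    · rw [hf.mem_iff]
      exact ZFSet.mem_singleton.2 rfl
  rw [H, mem_graphOf_iff ((hf.pair_iff _ x (g x)).2 rfl)] at hq
  exact hq.symm

theorem rightPower_comm (hlam : Order.IsSuccLimit lam) (hj : ClassElem j) {i m : ℕ}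
    (him : i ≤ m) (x : VSet lam) :
    rightPower j i (rightPower j m x) = rightPower j (m + 1) (rightPower j i x) :=
  apply_apply_of_extend hlam (elem_rightPower hlam hj i) (extend_rightPower hlam hj him) x

end RightPower

/-! ### Ranks -/

/-- The rank of an element of `V_λ`, as an element of `V_λ`. -/
noncomputable def rankV (x : VSet lam) : VSet lam := ordV x.1.rank (ZFSet.mem_vonNeumann.1 x.2)

theorem rank_lt (x : VSet lam) : x.1.rank < lam := ZFSet.mem_vonNeumann.1 x.2

@[simp] theorem rank_ordV {α : Ordinal.{u}} (h : α < lam) : (ordV α h).1.rank = α :=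
  Ordinal.rank_toZFSet α

theorem ordV_mem_ordV {α β : Ordinal.{u}} {hα : α < lam} {hβ : β < lam} :
    (ordV α hα).1 ∈ (ordV β hβ).1 ↔ α < β :=
  Ordinal.toZFSet_mem_toZFSet_iff

theorem mem_rankV {x z : VSet lam} :
    z.1 ∈ (rankV x).1 ↔ ∃ w : VSet lam, w.1 ∈ x.1 ∧ (z.1 ∈ (rankV w).1 ∨ z = rankV w) := by
  simp only [rankV, ordV, Ordinal.mem_toZFSet_iff, Subtype.ext_iff, ZFSet.lt_rank_iff]
  constructor
  · rintro ⟨a, ⟨w, hw, ha⟩, hz⟩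
    refine ⟨ofMem x hw, hw, ?_⟩
    obtain ha | ha := ha.lt_or_eq
    · exact Or.inl ⟨a, ZFSet.lt_rank_iff.1 ha, hz⟩
    · exact Or.inr (by rw [← hz, ha]; rfl)
  · rintro ⟨w, hw, ⟨a, ha, hz⟩ | hz⟩
    · exact ⟨a, ⟨w, hw, (ZFSet.lt_rank_iff.2 ha).le⟩, hz⟩
    · exact ⟨_, ⟨w, hw, le_rfl⟩, hz.symm⟩

/-- By ∈-induction the recursion has one solution. It is a first-order condition on a class, so `j`
maps the rank function to itself. -/
theorem eq_rankV {g : VSet lam → VSet lam}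
    (hg : ∀ x z : VSet lam, z.1 ∈ (g x).1 ↔
      ∃ w : VSet lam, w.1 ∈ x.1 ∧ (z.1 ∈ (g w).1 ∨ z = g w)) : g = rankV := by
  have (x : ZFSet.{u}) : ∀ hx : x ∈ V_ lam, g ⟨x, hx⟩ = rankV ⟨x, hx⟩ := by
    induction x using ZFSet.inductionOn with
    | h x ih =>
      intro hx
      refine VSet.ext_mem fun z => ?_
      rw [hg, mem_rankV]
      refine exists_congr fun w => and_congr_right fun hw => ?_
      rw [ih w.1 hw w.2]
  exact funext fun x => this x.1 x.2

namespace Fml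

variable {v : ℕ → VSet lam}

/-- The function with graph `0` satisfies the recursion that defines the rank. -/
def isRank : Fml 1 :=
  all 0 (all 1 (imp (pairCls 0 0 1) (all 2 (iff (mem 2 1)
    (ex 3 (and (mem 3 0) (ex 4 (and (pairCls 0 3 4) (or (mem 2 4) (eq 2 4))))))))))

theorem holds_isRank (hlam : Order.IsSuccLimit lam) {g : VSet lam → VSet lam} :
    isRank.Holds (fun _ => graphOf g) v ↔ g = rankV := by
  simp only [isRank, holds_and, holds_all, holds_imp, holds_ex, holds_iff,
    holds_mem, holds_pairCls, holds_or, holds_eq, exists_pair_mem_graphOf_iff hlam]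
  simp only [Function.update_self, ne_eq, OfNat.zero_ne_ofNat, zero_ne_one, Nat.reduceEqDiff,
    OfNat.one_ne_ofNat, not_false_eq_true, Function.update_of_ne, forall_eq', exists_eq_left']
  refine ⟨eq_rankV, ?_⟩
  rintro rfl x z
  exact mem_rankV

/-- `a` consists of the sets whose image under the function with graph `0` belongs to `b`. -/
def isLevel : Fml 1 :=
  all 2 (iff (mem 2 0) (ex 3 (and (pairCls 0 2 3) (mem 3 1))))

theorem holds_isLevel (hlam : Order.IsSuccLimit lam) {g : VSet lam → VSet lam} :
    isLevel.Holds (fun _ => graphOf g) v ↔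
      ∀ x : VSet lam, x.1 ∈ (v 0).1 ↔ (g x).1 ∈ (v 1).1 := by
  simp only [isLevel, holds_and, holds_all, holds_ex, holds_iff,
    holds_mem, holds_pairCls, exists_pair_mem_graphOf_iff hlam]
  simp only [Function.update_self, ne_eq, OfNat.zero_ne_ofNat, Nat.reduceEqDiff,
    OfNat.one_ne_ofNat, not_false_eq_true, Function.update_of_ne, exists_eq_left']

/-- The function with graph `0` fixes all elements of `a`. -/
def fixes : Fml 1 := all 1 (imp (mem 1 0) (pairCls 0 1 1))

theorem holds_fixes (hlam : Order.IsSuccLimit lam) {g : VSet lam → VSet lam} :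
    fixes.Holds (fun _ => graphOf g) v ↔ ∀ x : VSet lam, x.1 ∈ (v 0).1 → g x = x := by
  simp only [fixes, holds_all, holds_imp, holds_mem, holds_pairCls,
    exists_pair_mem_graphOf_iff hlam]
  simp only [Function.update_self, ne_eq, zero_ne_one, not_false_eq_true, Function.update_of_ne]

end Fml

/-- `V_α`, as an element of `V_λ`. -/
noncomputable def levelV (α : Ordinal.{u}) (h : α < lam) : VSet lam :=
  ⟨V_ α, ZFSet.vonNeumann_mem_of_lt h⟩

theorem mem_levelV {α : Ordinal.{u}} {h : α < lam} {x : VSet lam} :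
    x.1 ∈ (levelV α h).1 ↔ x.1.rank < α := ZFSet.mem_vonNeumann

theorem onOrd_lt {j : VSet lam → VSet lam} {α : Ordinal.{u}} (h : α < lam) : onOrd j α < lam := by
  rw [onOrd, dif_pos h]
  exact rank_lt _

/-! ### Action on ordinals and the critical sequence -/

section

variable {j : VSet lam → VSet lam} (hlam : Order.IsSuccLimit lam) (hj : ClassElem j)
include hlam hj

theorem extend_rankV : extend j (graphOf rankV) = graphOf rankV := by
  obtain ⟨h, hh⟩ := hj.exists_extend_eq_graphOf hlam rankV
  have := hj 1 .isRank (fun _ => graphOf rankV) fun _ => levelV 0 hlam.bot_lt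
  rw [hh, Fml.holds_isRank hlam, Fml.holds_isRank hlam] at this
  rw [hh, this.1 rfl]

theorem map_rankV (x : VSet lam) : j (rankV x) = rankV (j x) :=
  apply_apply_of_extend hlam hj.elem (extend_rankV hlam hj) x

theorem map_ordV {α : Ordinal.{u}} (h : α < lam) :
    j (ordV α h) = ordV (onOrd j α) (onOrd_lt h) := by
  have h₁ : rankV (ordV α h) = ordV α h := by simp [rankV]
  rw [← h₁, map_rankV hlam hj]
  simp [onOrd, h, rankV]

theorem rank_map (x : VSet lam) : (j x).1.rank = onOrd j x.1.rank := by
  have := congrArg (fun y => y.1.rank) (map_rankV hlam hj x)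
  simpa [rankV, map_ordV hlam hj] using this.symm

theorem map_levelV {α : Ordinal.{u}} (h : α < lam) :
    j (levelV α h) = levelV (onOrd j α) (onOrd_lt h) := by
  have := hj 1 .isLevel (fun _ => graphOf rankV)
    fun i => if i = 0 then levelV α h else ordV α h
  rw [extend_rankV hlam hj, Fml.holds_isLevel hlam, Fml.holds_isLevel hlam] at this
  have h' := this.1 fun x => by simp [mem_levelV, rankV, ordV_mem_ordV]
  refine VSet.ext_mem fun z => ?_
  have hz := h' z
  simp only [Function.comp_apply, if_true, one_ne_zero, if_false, map_ordV hlam hj] at hz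
  rw [hz, mem_levelV, rankV, ordV_mem_ordV]

theorem onOrd_lt_onOrd {α β : Ordinal.{u}} (hαβ : α < β) (hβ : β < lam) :
    onOrd j α < onOrd j β := by
  have := (hj.elem.mem_iff (ordV α (hαβ.trans hβ)) (ordV β hβ)).2 (ordV_mem_ordV.2 hαβ)
  rwa [map_ordV hlam hj, map_ordV hlam hj, ordV_mem_ordV] at this

theorem le_onOrd {α : Ordinal.{u}} (hα : α < lam) : α ≤ onOrd j α := by
  induction α using WellFoundedLT.induction with
  | ind α ih =>
    by_contra! h
    exact (ih _ h (h.trans hα)).not_gt (onOrd_lt_onOrd hlam hj h hα)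

/-- Induction on rank: `x` and `j x` have equal rank, so all elements of either have smaller rank
and are fixed. -/
theorem map_eq_self_of_forall {x : VSet lam}
    (hx : ∀ α ≤ x.1.rank, ¬ α < onOrd j α) : j x = x := by
  obtain ⟨r, hr⟩ : ∃ r, r = x.1.rank := ⟨_, rfl⟩
  induction r using WellFoundedLT.induction generalizing x with
  | ind r ih =>
    subst hr
    have hrank : (j x).1.rank = x.1.rank := by
      rw [rank_map hlam hj]
      exact le_antisymm (not_lt.1 (hx _ le_rfl)) (le_onOrd hlam hj (rank_lt x))
    have hfix (z : VSet lam) (hz : z.1.rank < x.1.rank) : j z = z :=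
      ih _ hz (fun α hα => hx α (hα.trans hz.le)) rfl
    refine VSet.ext_mem fun z => ⟨fun hz => ?_, fun hz => ?_⟩
    · have := hfix z (hrank ▸ ZFSet.rank_lt_of_mem hz)
      rwa [← hj.elem.mem_iff, this]
    · have := hfix z (ZFSet.rank_lt_of_mem hz)
      rwa [← hj.elem.mem_iff, this] at hz

theorem map_eq_self_of_rank_lt_crit {x : VSet lam} (hx : x.1.rank < crit j) : j x = x :=
  map_eq_self_of_forall hlam hj fun _ hα h =>
    notMem_of_lt_csInf' (hα.trans_lt hx) ⟨hα.trans_lt (rank_lt x), h⟩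

theorem crit_mem (hne : ∃ x, j x ≠ x) : crit j < lam ∧ crit j < onOrd j (crit j) := by
  refine csInf_mem (s := {α | α < lam ∧ α < onOrd j α}) ?_
  by_contra h
  obtain ⟨x, hx⟩ := hne
  exact hx <| map_eq_self_of_forall hlam hj fun α hα hlt =>
    h ⟨α, hα.trans_lt (rank_lt x), hlt⟩

variable (hne : ∃ x, j x ≠ x)
include hne

theorem critSeq_lt (n : ℕ) : critSeq j n < lam := by
  induction n with
  | zero => exact (crit_mem hlam hj hne).1
  | succ n ih => exact onOrd_lt ih

theorem critSeq_strictMono : StrictMono (critSeq j) := by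
  refine strictMono_nat_of_lt_succ fun n => ?_
  induction n with
  | zero => exact (crit_mem hlam hj hne).2
  | succ n ih => exact onOrd_lt_onOrd hlam hj ih (critSeq_lt hlam hj hne _)

theorem map_critSeq (n : ℕ) : j (ordV (critSeq j n) (critSeq_lt hlam hj hne n)) =
    ordV (critSeq j (n + 1)) (critSeq_lt hlam hj hne (n + 1)) :=
  map_ordV hlam hj _

theorem map_level_critSeq (n : ℕ) : j (levelV (critSeq j n) (critSeq_lt hlam hj hne n)) =
    levelV (critSeq j (n + 1)) (critSeq_lt hlam hj hne (n + 1)) :=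
  map_levelV hlam hj _

/-- If j x = κ₀ < j κ₀, then x ∈ κ₀, so `x` is fixed and κ₀ ∈ κ₀. -/
theorem map_ne_crit (x : VSet lam) : (j x).1 ≠ (crit j).toZFSet := by
  intro h
  have hc := crit_mem hlam hj hne
  have : x.1 ∈ (ordV (crit j) hc.1).1 := by
    rw [← hj.elem.mem_iff, map_ordV hlam hj, h]
    exact Ordinal.toZFSet_mem_toZFSet_iff.2 hc.2
  have hr := ZFSet.rank_lt_of_mem this
  rw [rank_ordV] at hr
  rw [map_eq_self_of_rank_lt_crit hlam hj hr] at h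
  rw [h, Ordinal.rank_toZFSet] at hr
  exact hr.false

/-- Induction through j (j^(n) κ_n) = j^(n+1) (j κ_n). -/
theorem rightPower_critSeq (n : ℕ) :
    rightPower j n (ordV (critSeq j n) (critSeq_lt hlam hj hne n)) =
      ordV (critSeq j (n + 1)) (critSeq_lt hlam hj hne (n + 1)) := by
  induction n with
  | zero => exact map_critSeq hlam hj hne 0
  | succ n ih =>
    have := rightPower_comm hlam hj (Nat.zero_le n)
      (ordV (critSeq j n) (critSeq_lt hlam hj hne n))
    rwa [ih, rightPower, map_critSeq hlam hj hne, map_critSeq hlam hj hne, eq_comm] at this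

/-- `j` turns "j^(n) fixes V_{κ_n} pointwise" into the same statement for n + 1. -/
theorem rightPower_eq_self {n : ℕ} {x : VSet lam} (hx : x.1.rank < critSeq j n) :
    rightPower j n x = x := by
  induction n generalizing x with
  | zero => exact map_eq_self_of_rank_lt_crit hlam hj hx
  | succ n ih =>
    have := hj 1 .fixes (fun _ => graphOf (rightPower j n))
      fun _ => levelV (critSeq j n) (critSeq_lt hlam hj hne n)
    rw [(rightPower_spec hlam hj n).1, Fml.holds_fixes hlam, Fml.holds_fixes hlam] at this
    refine this.1 (fun x hx => ih (mem_levelV.1 hx)) x ?_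
    rwa [Function.comp_apply, map_level_critSeq hlam hj hne, mem_levelV]

end

/-! ### A Jónsson-type function -/

section Jonsson

open Cardinal

/-- A family of `#I` many sets of size at least `#I` has an injective choice function. -/
theorem exists_injective_choice {I X : Type u} {S : I → Set X} (hS : ∀ x, #I ≤ #(S x)) :
    ∃ s : I → X, Function.Injective s ∧ ∀ x, s x ∈ S x := by
  -- In a well-order of least possible type fewer than `#I` values are used before any `x`, so `S x`
  -- is never exhausted.
  obtain ⟨r, _, hr⟩ := exists_ord_eq_type_lt I
  have key (x : I) (g : ∀ y, y < x → X) : ∃ z ∈ S x, ∀ y hy, g y hy ≠ z := by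
    by_contra! h
    choose y hy hyz using h
    have hinj : Function.Injective (fun z : S x => (⟨y z z.2, hy z z.2⟩ : Set.Iio x)) := by
      intro z w hzw
      have : y z z.2 = y w w.2 := congrArg Subtype.val hzw
      refine Subtype.ext ?_
      rw [← hyz z z.2, ← hyz w w.2]
      congr 1
    exact ((mk_Iio_lt x hr).trans_le (hS x)).not_ge (mk_le_of_injective hinj)
  choose s hs hs' using key
  let σ : I → X := wellFounded_lt.fix s
  have hσ (x : I) : σ x = s x fun y _ => σ y := wellFounded_lt.fix_eq s x
  have hne (x y : I) (h : y < x) : σ y ≠ σ x := by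
    rw [hσ x]
    exact hs' x (fun y _ => σ y) y h
  refine ⟨σ, fun x y hxy => ?_, fun x => by rw [hσ]; exact hs _ _⟩
  rcases lt_trichotomy x y with h | h | h
  exacts [(hne y x h hxy).elim, h, (hne x y h hxy.symm).elim]

/-- If `B` has at least `2 ^ #B` many `ω`-sequences, there is a function on these that takes every
value on the sequences in every subset of `B` of full size. -/
theorem exists_jonsson {B : Type*} [Infinite B] (hB : #(B → B) ≤ #(ℕ → B)) :
    ∃ F : (ℕ → B) → B, ∀ i : B → B, Function.Injective i → ∀ b, ∃ t : ℕ → B, F (i ∘ t) = b := by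
  let I := {i : B → B // Function.Injective i} × B
  have hI : #I ≤ #(ℕ → B) := by
    refine le_trans ?_ hB
    have h₁ : #{i : B → B // Function.Injective i} ≤ #(B → B) := mk_subtype_le _
    have h₂ : #B ≤ #(B → B) := mk_le_of_injective (f := fun b _ => b) Function.const_injective
    rw [mk_prod, lift_id, lift_id]
    exact (mul_le_mul' h₁ h₂).trans (mul_eq_self ((aleph0_le_mk B).trans h₂)).le
  -- Each requirement (i, b) gets its own sequence in the range of `i`; there are enough because
  -- composing with `i` is injective. Then `F` reads off `b`.
  obtain ⟨s, hs, hsS⟩ := exists_injective_choice (I := I)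
    (S := fun x => Set.range fun t : ℕ → B => x.1.1 ∘ t) (fun x => by
      rwa [mk_range_eq _ x.1.2.comp_left])
  refine ⟨Function.extend s Prod.snd fun _ => Classical.arbitrary B, fun i hi b => ?_⟩
  obtain ⟨t, ht⟩ := hsS (⟨i, hi⟩, b)
  exact ⟨t, by rw [show i ∘ t = s (⟨i, hi⟩, b) from ht, hs.extend_apply]⟩

end Jonsson

theorem mem_cut {A : Set (VSet lam)} {α : Set.Iio lam} {x : VSet lam} :
    x.1 ∈ (cut A α).1 ↔ x.1.rank < α.1 ∧ x ∈ A := by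
  rw [cut, ZFSet.mem_sep, ZFSet.mem_vonNeumann]
  exact and_congr_right fun _ => ⟨fun ⟨_, h⟩ => h, fun h => ⟨x.2, h⟩⟩

/-- If `λ` has cofinality `ω`, then `V_λ` has at least as many `ω`-sequences as self-maps. -/
theorem mk_fun_le_mk_seq (hlam : Order.IsSuccLimit lam) {c : ℕ → Ordinal.{u}}
    (hc : ∀ n, c n < lam) (hcof : ∀ α < lam, ∃ n, α < c n) :
    Cardinal.mk (VSet lam → VSet lam) ≤ Cardinal.mk (ℕ → VSet lam) := by
  -- A self-map is coded by the cuts of its graph at the levels `c n`.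
  refine Cardinal.mk_le_of_injective (f := fun g n => cut (graphOf g) ⟨c n, hc n⟩)
    fun g h hgh => graphOf_injective hlam (Set.ext fun x => ?_)
  obtain ⟨n, hn⟩ := hcof _ (rank_lt x)
  have h₁ : cut (graphOf g) ⟨c n, hc n⟩ = cut (graphOf h) ⟨c n, hc n⟩ := congrFun hgh n
  have h₂ := mem_cut (A := graphOf g) (α := ⟨c n, hc n⟩) (x := x)
  rw [h₁, mem_cut] at h₂
  simpa [hn] using h₂.symm

/-! ### Natural numbers and sequences -/

namespace Fml

variable {p : ℕ} {A : Fin p → Set (VSet lam)} {v : ℕ → VSet lam}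

/-- Every nonempty element of `0` has a largest element. -/
def hasMax : Fml p :=
  all 1 (imp (mem 1 0) (imp (ex 2 (mem 2 1))
    (ex 2 (and (mem 2 1) (all 3 (imp (mem 3 1) (or (mem 3 2) (eq 3 2))))))))

theorem holds_hasMax : hasMax.Holds A v ↔ ∀ x : VSet lam, x.1 ∈ (v 0).1 →
    (∃ y : VSet lam, y.1 ∈ x.1) → ∃ y : VSet lam, y.1 ∈ x.1 ∧
      ∀ z : VSet lam, z.1 ∈ x.1 → z.1 ∈ y.1 ∨ z = y := by
  simp only [hasMax, holds_all, holds_imp, holds_mem, holds_ex, holds_and, holds_or, holds_eq]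
  simp only [Function.update_self, ne_eq, zero_ne_one, Nat.reduceEqDiff,
    OfNat.one_ne_ofNat, not_false_eq_true, Function.update_of_ne]

/-- `0` is a function from `1` to `2`. -/
def isSeq : Fml p :=
  and (all 10 (imp (mem 10 1) (ex 11 (and (mem 11 2) (and (pairMem 10 11 0)
      (all 12 (imp (pairMem 10 12 0) (eq 12 11))))))))
    (all 10 (imp (mem 10 0) (ex 11 (ex 12 (and (mem 11 1) (isPair 10 11 12))))))

end Fml

/-- `t` is a function from `w` to `b`, in terms of elements of `V_λ`. -/
def IsSeq (t w b : VSet lam) : Prop :=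
  (∀ n : VSet lam, n.1 ∈ w.1 → ∃ y : VSet lam, y.1 ∈ b.1 ∧ ZFSet.pair n.1 y.1 ∈ t.1 ∧
    ∀ z : VSet lam, ZFSet.pair n.1 z.1 ∈ t.1 → z = y) ∧
  ∀ q : VSet lam, q.1 ∈ t.1 → ∃ n y : VSet lam, n.1 ∈ w.1 ∧ q.1 = ZFSet.pair n.1 y.1

namespace Fml

variable {p : ℕ} {A : Fin p → Set (VSet lam)} {v : ℕ → VSet lam}

theorem holds_isSeq : isSeq.Holds A v ↔ IsSeq (v 0) (v 1) (v 2) := by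
  simp only [isSeq, holds_all, holds_imp, holds_mem, holds_ex, holds_and, holds_eq,
    holds_pairMem, holds_isPair]
  simp only [Function.update_self, ne_eq, OfNat.zero_ne_ofNat, Nat.reduceEqDiff,
    OfNat.one_ne_ofNat, not_false_eq_true, Function.update_of_ne]
  exact Iff.rfl

/-- The class `0` is single-valued, and for every injective function `3` from `2` to `2` and every
`4` in `2` there is a function `0` from `1` to `2` such that the class contains the pair of the
composition `5` of `0` and `3` with `4`. -/
def isJonsson : Fml 1 :=
  and (all 3 (all 4 (all 5 (imp (pairCls 0 3 4) (imp (pairCls 0 3 5) (eq 4 5))))))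
    (all 3 (imp
      (and (all 10 (imp (mem 10 2) (ex 11 (and (mem 11 2) (pairMem 10 11 3)))))
        (and (all 10 (all 11 (all 12 (imp (pairMem 10 11 3) (imp (pairMem 10 12 3) (eq 11 12))))))
          (all 10 (all 11 (all 12 (imp (pairMem 11 10 3) (imp (pairMem 12 10 3) (eq 11 12))))))))
      (all 4 (imp (mem 4 2) (ex 0 (ex 5 (and isSeq (and (pairCls 0 5 4)
        (all 10 (iff (mem 10 5) (ex 11 (ex 12 (ex 13 (and (isPair 10 11 13)
          (and (pairMem 11 12 0) (pairMem 12 13 3))))))))))))))))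

theorem holds_isJonsson {F : Set (VSet lam)} : isJonsson.Holds (fun _ => F) v ↔
    (∀ s b b' : VSet lam, (∃ q ∈ F, q.1 = ZFSet.pair s.1 b.1) →
      (∃ q ∈ F, q.1 = ZFSet.pair s.1 b'.1) → b = b') ∧
    ∀ i : VSet lam,
      ((∀ x : VSet lam, x.1 ∈ (v 2).1 →
          ∃ y : VSet lam, y.1 ∈ (v 2).1 ∧ ZFSet.pair x.1 y.1 ∈ i.1) ∧
        (∀ x y y' : VSet lam, ZFSet.pair x.1 y.1 ∈ i.1 → ZFSet.pair x.1 y'.1 ∈ i.1 → y = y') ∧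
        ∀ y x x' : VSet lam, ZFSet.pair x.1 y.1 ∈ i.1 → ZFSet.pair x'.1 y.1 ∈ i.1 → x = x') →
      ∀ b : VSet lam, b.1 ∈ (v 2).1 → ∃ t s : VSet lam, IsSeq t (v 1) (v 2) ∧
        (∃ q ∈ F, q.1 = ZFSet.pair s.1 b.1) ∧
        ∀ q : VSet lam, q.1 ∈ s.1 ↔ ∃ n x y : VSet lam, q.1 = ZFSet.pair n.1 y.1 ∧
          ZFSet.pair n.1 x.1 ∈ t.1 ∧ ZFSet.pair x.1 y.1 ∈ i.1 := by
  simp only [isJonsson, holds_all, holds_imp, holds_mem, holds_ex, holds_and, holds_eq,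
    holds_pairMem, holds_isPair, holds_pairCls, holds_iff, holds_isSeq]
  simp only [Function.update_self, ne_eq, OfNat.zero_ne_ofNat, Nat.reduceEqDiff, one_ne_zero,
    OfNat.ofNat_ne_zero, OfNat.one_ne_ofNat, not_false_eq_true, Function.update_of_ne]

end Fml

/-! ### `j` fixes ω and acts termwise on ω-sequences -/

section

variable {j : VSet lam → VSet lam} (hlam : Order.IsSuccLimit lam) (hj : ClassElem j)
include hlam hj

theorem onOrd_natCast (n : ℕ) : onOrd j n = n := by
  have hω (n : ℕ) : (n : Ordinal.{u}) < lam :=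
    (Ordinal.natCast_lt_omega0 n).trans_le (Ordinal.omega0_le_of_isSuccLimit hlam)
  induction n with
  | zero =>
    have := hj.elem (.all 1 (.neg (.mem 1 0))) fun _ => ordV (0 : ℕ) (hω 0)
    simp only [Fml.holds_all, Fml.holds_neg, Fml.holds_mem, Function.update_self, ne_eq,
      zero_ne_one, not_false_eq_true, Function.update_of_ne, Function.comp_apply] at this
    have h := this.1 (by simp [ordV])
    rw [map_ordV hlam hj] at h
    by_contra hne
    exact h (ordV 0 hlam.bot_lt) (ordV_mem_ordV.2 (pos_iff_ne_zero.2 (by simpa using hne)))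
  | succ n ih =>
    -- The rank of {n} is n + 1, and `j` maps {n} to {j n}.
    let s : VSet lam := ⟨{(ordV n (hω n)).1, (ordV n (hω n)).1},
      insert_mem_vonNeumann hlam (ordV n (hω n)).2
        (singleton_mem_vonNeumann hlam (ordV n (hω n)).2)⟩
    have := hj.elem (.isUpair 0 1 1) fun i => if i = 0 then s else ordV n (hω n)
    simp only [Fml.holds_isUpair, Function.comp_apply, if_true, one_ne_zero, if_false] at this
    have h := congrArg ZFSet.rank (this.1 rfl)
    rw [rank_map hlam hj, map_ordV hlam hj] at h
    simpa [s, ih] using h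

/-- Every nonempty element of ω has a largest element. If ω < j ω, this would transfer to ω itself.
-/
theorem onOrd_omega (hω : Ordinal.omega0 < lam) : onOrd j Ordinal.omega0 = Ordinal.omega0 := by
  refine le_antisymm ?_ (le_onOrd hlam hj hω)
  have := hj.elem .hasMax fun _ => ordV _ hω
  rw [Fml.holds_hasMax, Fml.holds_hasMax] at this
  have h := this.1 fun x hx ⟨y, hy⟩ => by
    obtain ⟨a, ha, hax⟩ := Ordinal.mem_toZFSet_iff.1 hx
    obtain ⟨n, rfl⟩ := Ordinal.lt_omega0.1 ha
    cases n with
    | zero => rw [← hax] at hy; simp at hy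
    | succ n =>
      refine ⟨ordV n ((Ordinal.natCast_lt_omega0 n).trans hω), ?_, fun z hz => ?_⟩
      · rw [← hax]
        exact Ordinal.toZFSet_mem_toZFSet_iff.2 (by exact_mod_cast Nat.lt_succ_self n)
      · rw [← hax, Nat.cast_succ, Ordinal.toZFSet_add_one, ZFSet.mem_insert_iff] at hz
        exact hz.symm.imp id Subtype.ext
  by_contra! hlt
  rw [Function.comp_apply, map_ordV hlam hj] at h
  obtain ⟨y, hy, hmax⟩ := h (ordV _ hω) (ordV_mem_ordV.2 hlt)
    ⟨ordV 0 hlam.bot_lt, ordV_mem_ordV.2 Ordinal.omega0_pos⟩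
  obtain ⟨a, ha, hay⟩ := Ordinal.mem_toZFSet_iff.1 hy
  have ha' : Order.succ a < Ordinal.omega0 := Ordinal.isSuccLimit_omega0.succ_lt ha
  have hmem := hmax (ordV (Order.succ a) (ha'.trans hω)) (ordV_mem_ordV.2 ha')
  rw [Subtype.ext_iff, ← hay] at hmem
  obtain h | h := hmem
  · exact (Ordinal.toZFSet_mem_toZFSet_iff.1 h).not_gt (Order.lt_succ a)
  · exact (Order.lt_succ a).ne' (Ordinal.toZFSet_injective h)

theorem map_omega (hω : Ordinal.omega0 < lam) :
    j (ordV Ordinal.omega0 hω) = ordV Ordinal.omega0 hω := by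
  rw [map_ordV hlam hj]
  simp only [onOrd_omega hlam hj hω]

theorem map_eq_self_of_mem_omega {hω : Ordinal.omega0 < lam} {x : VSet lam}
    (hx : x.1 ∈ (ordV Ordinal.omega0 hω).1) : j x = x := by
  obtain ⟨a, ha, hax⟩ := Ordinal.mem_toZFSet_iff.1 hx
  obtain ⟨n, rfl⟩ := Ordinal.lt_omega0.1 ha
  obtain rfl : ordV (n : Ordinal.{u}) (ha.trans hω) = x := Subtype.ext hax
  rw [map_ordV hlam hj]
  simp only [onOrd_natCast hlam hj]

theorem IsSeq.map {hω : Ordinal.omega0 < lam} {t b : VSet lam}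
    (ht : IsSeq t (ordV Ordinal.omega0 hω) b) : IsSeq (j t) (ordV Ordinal.omega0 hω) (j b) := by
  have := hj.elem .isSeq fun i => if i = 0 then t else if i = 1 then ordV _ hω else b
  simp only [Fml.holds_isSeq, Function.comp_apply, if_true, one_ne_zero, if_false,
    OfNat.ofNat_ne_zero, OfNat.ofNat_ne_one, map_omega hlam hj] at this
  exact this.1 ht

theorem IsSeq.mem_map_iff {hω : Ordinal.omega0 < lam} {t b : VSet lam}
    (ht : IsSeq t (ordV Ordinal.omega0 hω) b) (q : VSet lam) :
    q.1 ∈ (j t).1 ↔ ∃ n x : VSet lam, ZFSet.pair n.1 x.1 ∈ t.1 ∧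
      q.1 = ZFSet.pair n.1 (j x).1 := by
  have key (n x : VSet lam) (h : ZFSet.pair n.1 x.1 ∈ t.1) :
      n.1 ∈ (ordV Ordinal.omega0 hω).1 ∧ ZFSet.pair n.1 (j x).1 ∈ (j t).1 := by
    obtain ⟨n', y, hn', h'⟩ := ht.2 (ofMem t h) h
    have hn : n.1 ∈ (ordV Ordinal.omega0 hω).1 := by
      rw [(ZFSet.pair_inj.1 h').1]
      exact hn'
    refine ⟨hn, ?_⟩
    have := (hj.elem.pair_mem_iff n x t).2 h
    rwa [map_eq_self_of_mem_omega hlam hj hn] at this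
  constructor
  · intro hq
    obtain ⟨n, y, hn, hqy⟩ := (ht.map hlam hj).2 q hq
    obtain ⟨x, hx, hxt, -⟩ := ht.1 n hn
    obtain ⟨z, -, -, hz⟩ := (ht.map hlam hj).1 n hn
    refine ⟨n, x, hxt, ?_⟩
    rw [hqy] at hq ⊢
    rw [hz _ hq, hz _ (key n x hxt).2]
  · rintro ⟨n, x, h, hq⟩
    rw [hq]
    exact (key n x h).2

end

/-! ### The critical sequence is cofinal -/

section SeqV

variable {η : Ordinal.{u}}

/-- An `ω`-sequence of elements of `V_η`, as an element of `V_λ`. -/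
noncomputable def seqV (hη : η < lam) (t : ℕ → VSet η) : VSet lam :=
  ⟨ZFSet.sep (fun q => ∃ n : ℕ, q = ZFSet.pair (n : Ordinal.{u}).toZFSet (t n).1) (V_ η),
    ZFSet.mem_vonNeumann_of_subset ZFSet.sep_subset (ZFSet.vonNeumann_mem_of_lt hη)⟩

theorem natCast_toZFSet_mem (hlim : Order.IsSuccLimit η) (n : ℕ) :
    (n : Ordinal.{u}).toZFSet ∈ V_ η := by
  rw [ZFSet.mem_vonNeumann, Ordinal.rank_toZFSet]
  exact (Ordinal.natCast_lt_omega0 n).trans_le (Ordinal.omega0_le_of_isSuccLimit hlim)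

theorem mem_seqV {hη : η < lam} (hlim : Order.IsSuccLimit η) {t : ℕ → VSet η} {q : ZFSet.{u}} :
    q ∈ (seqV hη t).1 ↔ ∃ n : ℕ, q = ZFSet.pair (n : Ordinal.{u}).toZFSet (t n).1 := by
  rw [seqV, ZFSet.mem_sep, and_iff_right_iff_imp]
  rintro ⟨n, rfl⟩
  exact pair_mem_vonNeumann hlim (natCast_toZFSet_mem hlim n) (t n).2

theorem natCast_toZFSet_inj {m n : ℕ} :
    (m : Ordinal.{u}).toZFSet = (n : Ordinal.{u}).toZFSet ↔ m = n :=
  Ordinal.toZFSet_injective.eq_iff.trans Nat.cast_inj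

theorem pair_mem_seqV {hη : η < lam} (hlim : Order.IsSuccLimit η) {t : ℕ → VSet η} {n : ℕ}
    {y : ZFSet.{u}} :
    ZFSet.pair (n : Ordinal.{u}).toZFSet y ∈ (seqV hη t).1 ↔ y = (t n).1 := by
  rw [mem_seqV hlim]
  constructor
  · rintro ⟨m, hm⟩
    rw [ZFSet.pair_inj, natCast_toZFSet_inj] at hm
    rw [hm.2, hm.1]
  · rintro rfl
    exact ⟨n, rfl⟩

theorem seqV_injective {hη : η < lam} (hlim : Order.IsSuccLimit η) :
    Function.Injective (seqV hη) := by
  intro s t hst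
  ext1 n
  have : ZFSet.pair (n : Ordinal.{u}).toZFSet (s n).1 ∈ (seqV hη t).1 := by
    rw [← hst, pair_mem_seqV hlim]
  exact Subtype.ext ((pair_mem_seqV hlim).1 this)

theorem isSeq_seqV {hη : η < lam} (hlim : Order.IsSuccLimit η) {hω : Ordinal.omega0 < lam}
    (t : ℕ → VSet η) : IsSeq (seqV hη t) (ordV Ordinal.omega0 hω) (levelV η hη) := by
  constructor
  · intro n hn
    obtain ⟨a, ha, han⟩ := Ordinal.mem_toZFSet_iff.1 hn
    obtain ⟨m, rfl⟩ := Ordinal.lt_omega0.1 ha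
    refine ⟨ofMem (levelV η hη) (t m).2, (t m).2, ?_, fun z hz => ?_⟩
    · rw [← han, pair_mem_seqV hlim]
      rfl
    · rw [← han, pair_mem_seqV hlim] at hz
      exact Subtype.ext hz
  · intro q hq
    obtain ⟨n, hn⟩ := (mem_seqV hlim).1 hq
    exact ⟨ordV n ((Ordinal.natCast_lt_omega0 n).trans hω), ofMem (levelV η hη) (t n).2,
      ordV_mem_ordV.2 (Ordinal.natCast_lt_omega0 n), hn⟩

end SeqV

namespace Fml

variable {p : ℕ} {A : Fin p → Set (VSet lam)} {v : ℕ → VSet lam}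

/-- Every element of `0` belongs to a value of the function `1`. -/
def covers : Fml p := all 2 (imp (mem 2 0) (ex 3 (ex 4 (and (pairMem 3 4 1) (mem 2 4)))))

theorem holds_covers : covers.Holds A v ↔ ∀ x : VSet lam, x.1 ∈ (v 0).1 →
    ∃ n y : VSet lam, ZFSet.pair n.1 y.1 ∈ (v 1).1 ∧ x.1 ∈ y.1 := by
  simp only [covers, holds_all, holds_imp, holds_mem, holds_ex, holds_and, holds_pairMem]
  simp only [Function.update_self, ne_eq, OfNat.zero_ne_ofNat, Nat.reduceEqDiff,
    OfNat.one_ne_ofNat, not_false_eq_true, Function.update_of_ne]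

end Fml

/-- The restriction of `j` to `V_η`, as an element of `V_λ`. -/
noncomputable def restrictV {η : Ordinal.{u}} (hη : η < lam) (j : VSet lam → VSet lam) :
    VSet lam :=
  ⟨ZFSet.sep (fun q => ∃ x : VSet lam, x.1 ∈ V_ η ∧ q = ZFSet.pair x.1 (j x).1) (V_ η),
    ZFSet.mem_vonNeumann_of_subset ZFSet.sep_subset (ZFSet.vonNeumann_mem_of_lt hη)⟩

theorem pair_mem_restrictV {η : Ordinal.{u}} {hη : η < lam} (hlim : Order.IsSuccLimit η)
    {j : VSet lam → VSet lam} (hjη : ∀ x : VSet lam, x.1 ∈ V_ η → (j x).1 ∈ V_ η)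
    {x y : VSet lam} :
    ZFSet.pair x.1 y.1 ∈ (restrictV hη j).1 ↔ x.1 ∈ V_ η ∧ y = j x := by
  rw [restrictV, ZFSet.mem_sep]
  constructor
  · rintro ⟨-, z, hz, h⟩
    rw [ZFSet.pair_inj] at h
    obtain rfl : x = z := Subtype.ext h.1
    exact ⟨hz, Subtype.ext h.2⟩
  · rintro ⟨hx, rfl⟩
    exact ⟨pair_mem_vonNeumann hlim hx (hjη x hx), x, hx, rfl⟩

/-! ### Kunen's argument -/

section

variable {j : VSet lam → VSet lam} (hlam : Order.IsSuccLimit lam) (hj : ClassElem j)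
  (hne : ∃ x, j x ≠ x)
include hlam hj hne

/-- `j` maps the sequence of the V_{κ_n} to that of the V_{κ_{n+1}}, and both have union V_η. -/
theorem map_level_of_critSeq_cofinal {η : Ordinal.{u}} (hη : η < lam)
    (hlim : Order.IsSuccLimit η) (hlt : ∀ n, critSeq j n < η)
    (hcof : ∀ α < η, ∃ n, α < critSeq j n) : j (levelV η hη) = levelV η hη := by
  have hω : Ordinal.omega0 < lam := (Ordinal.omega0_le_of_isSuccLimit hlim).trans_lt hη
  let t : ℕ → VSet η := fun n => levelV (critSeq j n) (hlt n)
  have ht := isSeq_seqV (hη := hη) hlim (hω := hω) t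
  have hcov := hj.elem .covers fun i => if i = 0 then levelV η hη else seqV hη t
  simp only [Fml.holds_covers, Function.comp_apply, if_true, one_ne_zero, if_false] at hcov
  have h := hcov.1 fun x hx => by
    obtain ⟨n, hn⟩ := hcof _ (mem_levelV.1 hx)
    refine ⟨ordV n ((Ordinal.natCast_lt_omega0 n).trans hω),
      levelV (critSeq j n) ((hlt n).trans hη), ?_, mem_levelV.2 hn⟩
    exact (pair_mem_seqV hlim).2 rfl
  refine VSet.ext_mem fun x => ⟨fun hx => ?_, fun hx => ?_⟩
  · obtain ⟨n, y, hny, hxy⟩ := h x hx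
    obtain ⟨n', z, hnz, heq⟩ := (ht.mem_map_iff hlam hj (ofMem _ hny)).1 hny
    have hyz : y = j z := Subtype.ext (ZFSet.pair_inj.1 heq).2
    obtain ⟨m, hm⟩ := (mem_seqV hlim).1 hnz
    have hz : z = levelV (critSeq j m) ((hlt m).trans hη) :=
      Subtype.ext (ZFSet.pair_inj.1 hm).2
    rw [hyz, hz, map_level_critSeq hlam hj hne, mem_levelV] at hxy
    exact mem_levelV.2 (hxy.trans (hlt _))
  · obtain ⟨n, hn⟩ := hcof _ (mem_levelV.1 hx)
    have hsub := (hj.elem.subset_iff (levelV (critSeq j n) ((hlt n).trans hη)) (levelV η hη)).2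
      (ZFSet.vonNeumann_subset_of_le (hlt n).le)
    refine hsub ?_
    rw [map_level_critSeq hlam hj hne, mem_levelV]
    exact hn.trans (critSeq_strictMono hlam hj hne n.lt_succ_self)

theorem not_critSeq_cofinal_of_lt {η : Ordinal.{u}} (hη : η < lam)
    (hlim : Order.IsSuccLimit η) (hlt : ∀ n, critSeq j n < η) :
    ¬ ∀ α < η, ∃ n, α < critSeq j n := by
  intro hcof
  have hω : Ordinal.omega0 < lam := (Ordinal.omega0_le_of_isSuccLimit hlim).trans_lt hη
  have : Infinite (VSet η) := Infinite.of_injective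
    (fun n : ℕ => (⟨_, natCast_toZFSet_mem hlim n⟩ : VSet η)) fun m n h =>
      natCast_toZFSet_inj.1 (congrArg Subtype.val h)
  obtain ⟨F₀, hF₀⟩ := exists_jonsson (mk_fun_le_mk_seq hlim hlt hcof)
  let F : Set (VSet lam) := {q | ∃ s : ℕ → VSet η, q.1 = ZFSet.pair (seqV hη s).1 (F₀ s).1}
  have hB := map_level_of_critSeq_cofinal hlam hj hne hη hlim hlt hcof
  have htransfer := hj 1 .isJonsson (fun _ => F)
    fun i => if i = 1 then ordV _ hω else levelV η hη
  simp only [Fml.holds_isJonsson, Function.comp_apply, if_true, OfNat.ofNat_ne_one, if_false,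
    map_omega hlam hj, hB] at htransfer
  obtain ⟨hfun, hJ⟩ := htransfer.1 (by
    refine ⟨?_, ?_⟩
    · rintro s b b' ⟨q, ⟨s₀, hq⟩, hqs⟩ ⟨q', ⟨s₁, hq'⟩, hqs'⟩
      rw [hq, ZFSet.pair_inj] at hqs
      rw [hq', ZFSet.pair_inj] at hqs'
      obtain rfl : s₀ = s₁ := seqV_injective hlim (Subtype.ext (hqs.1.trans hqs'.1.symm))
      exact Subtype.ext (hqs.2.symm.trans hqs'.2)
    · rintro i ⟨htot, hfun, hinj⟩ b hb
      choose g hgB hg using fun x : VSet η => htot (ofMem (levelV η hη) x.2) x.2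
      let g' : VSet η → VSet η := fun x => ⟨(g x).1, hgB x⟩
      have hg' : Function.Injective g' := by
        intro x y hxy
        have hgxy : g x = g y := Subtype.ext (congrArg (fun z : VSet η => z.1) hxy)
        have := hinj _ _ _ (hg x) (hgxy ▸ hg y)
        exact Subtype.ext (congrArg (fun z : VSet lam => z.1) this)
      obtain ⟨t, ht⟩ := hF₀ g' hg' ⟨b.1, hb⟩
      refine ⟨seqV hη t, seqV hη (g' ∘ t), isSeq_seqV hlim t,
        ⟨pairV hlam (seqV hη (g' ∘ t)) b, ⟨g' ∘ t, by rw [ht]; rfl⟩, rfl⟩, fun q => ?_⟩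
      rw [mem_seqV hlim]
      constructor
      · rintro ⟨n, hq⟩
        exact ⟨ordV n ((Ordinal.natCast_lt_omega0 n).trans hω), ofMem (levelV η hη) (t n).2,
          g (t n), hq, (pair_mem_seqV hlim).2 rfl, hg (t n)⟩
      · rintro ⟨n, x, y, hq, hnx, hxy⟩
        obtain ⟨m, hm⟩ := (mem_seqV hlim).1 hnx
        rw [ZFSet.pair_inj] at hm
        refine ⟨m, ?_⟩
        obtain rfl : x = ofMem (levelV η hη) (t m).2 := Subtype.ext hm.2
        rw [hq, hm.1, hfun _ _ _ hxy (hg (t m))]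
        rfl)
  have hjη (x : VSet lam) (hx : x.1 ∈ V_ η) : (j x).1 ∈ V_ η := by
    have := (hj.elem.mem_iff x (levelV η hη)).2 hx
    rwa [hB] at this
  have hres {x y : VSet lam} := pair_mem_restrictV (hη := hη) hlim hjη (x := x) (y := y)
  -- The transferred property of j · F is used for the injection j ↾ V_η and the value κ₀.
  obtain ⟨t, s, ht, hsF, hs⟩ := hJ (restrictV hη j) ⟨fun x hx => ⟨j x, hjη x hx, hres.2 ⟨hx, rfl⟩⟩,
    fun x y y' h h' => (hres.1 h).2.trans (hres.1 h').2.symm,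
    fun y x x' h h' => hj.elem.injective ((hres.1 h).2.symm.trans (hres.1 h').2)⟩
    (ordV (crit j) (crit_mem hlam hj hne).1) (mem_levelV.2 (by rw [rank_ordV]; exact hlt 0))
  have hst : s = j t := by
    refine VSet.ext_mem fun q => ?_
    rw [hs, ht.mem_map_iff hlam hj]
    constructor
    · rintro ⟨n, x, y, hq, hnx, hxy⟩
      exact ⟨n, x, hnx, by rw [hq, (hres.1 hxy).2]⟩
    · rintro ⟨n, x, hnx, hq⟩
      refine ⟨n, x, j x, hq, hnx, hres.2 ⟨?_, rfl⟩⟩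
      obtain ⟨n', y', hn', heq⟩ := ht.2 (ofMem t hnx) hnx
      have hnn' : n = n' := Subtype.ext (ZFSet.pair_inj.1 heq).1
      obtain ⟨y, hy, -, huniq⟩ := ht.1 n (hnn' ▸ hn')
      rw [huniq x hnx]
      exact hy
  rw [hst] at hsF
  -- That j · F has a value at `j t` reflects to a value `b` of F at `t`. Then `j b` and κ₀ are both
  -- values of j · F at `j t`, hence equal.
  have hex := hj 1 (.ex 1 (.pairCls 0 0 1)) (fun _ => F) fun _ => t
  simp only [Fml.holds_ex, Fml.holds_pairCls, Function.comp_apply, Function.update_self, ne_eq,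
    zero_ne_one, not_false_eq_true, Function.update_of_ne] at hex
  obtain ⟨b, hb⟩ := hex.2 ⟨_, hsF⟩
  have hpair := hj 1 (.pairCls 0 0 1) (fun _ => F) fun i => if i = 0 then t else b
  simp only [Fml.holds_pairCls, Function.comp_apply, if_true, one_ne_zero, if_false] at hpair
  exact map_ne_crit hlam hj hne b (congrArg Subtype.val (hfun _ _ _ (hpair.1 hb) hsF))

theorem exists_lt_critSeq {α : Ordinal.{u}} (hα : α < lam) : ∃ n, α < critSeq j n := by
  by_contra! h
  have hmono := critSeq_strictMono hlam hj hne
  have hlt (n : ℕ) : critSeq j n < ⨆ n, critSeq j n :=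
    (hmono n.lt_succ_self).trans_le (Ordinal.le_iSup (critSeq j) (n + 1))
  refine not_critSeq_cofinal_of_lt hlam hj hne (η := ⨆ n, critSeq j n)
    ((Ordinal.iSup_le h).trans_lt hα) ?_ hlt fun β hβ => Ordinal.lt_iSup_iff.1 hβ
  refine Order.isSuccLimit_iff_of_orderBot.2 ⟨(bot_le.trans_lt (hlt 0)).ne', ?_⟩
  refine Order.isSuccPrelimit_iff_succ_lt.2 fun β hβ => ?_
  obtain ⟨n, hn⟩ := Ordinal.lt_iSup_iff.1 hβ
  exact (Order.succ_le_of_lt hn).trans_lt (hlt n)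

end

/-! ### Finite compositions and inverse limits -/

/-- `k₀ ∘ k₁ ∘ ⋯ ∘ kₙ₋₁`. -/
def compBelow {X : Type*} (k : ℕ → X → X) : ℕ → X → X
  | 0 => id
  | n + 1 => compBelow k n ∘ k n

section CompBelow

variable {X : Type*} {k : ℕ → X → X}

theorem compUpTo_eq_compBelow (n : ℕ) : compUpTo k n = compBelow k (n + 1) := by
  induction n with
  | zero => rfl
  | succ n ih => rw [compUpTo, ih]; rfl

theorem compBelow_add (n r : ℕ) :
    compBelow k (n + r) = compBelow k n ∘ compBelow (fun i => k (n + i)) r := by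
  induction r with
  | zero => rfl
  | succ r ih => rw [← add_assoc, compBelow, ih, compBelow, Function.comp_assoc]

theorem compBelow_eq_self {a : X} (n : ℕ) (h : ∀ i < n, k i a = a) : compBelow k n a = a := by
  induction n with
  | zero => rfl
  | succ n ih =>
    rw [compBelow, Function.comp_apply, h n (by lia), ih fun i hi => h i (by lia)]

/-- Extra factors fix `a`, so the value is the same for all long enough compositions. This lets the
length vary freely later on. -/
theorem exists_inverseLimit_eq {a : X} (h : ∃ n, ∀ m > n, k m a = a) :
    ∃ N, ∀ M ≥ N, inverseLimit k a = compBelow k M a := by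
  classical
  refine ⟨Nat.find h + 1, fun M hM => ?_⟩
  obtain ⟨r, rfl⟩ := Nat.exists_eq_add_of_le hM
  rw [inverseLimit, dif_pos h, compUpTo_eq_compBelow, compBelow_add (Nat.find h + 1),
    Function.comp_apply,
    compBelow_eq_self r fun i _ => Nat.find_spec h _ (by lia)]

/-- Each of the `n` factors passed raises the index `m` by one. -/
theorem compBelow_comm (hk : ∀ i m, i ≤ m → ∀ x, k i (k m x) = k (m + 1) (k i x)) {n m : ℕ}
    (hnm : n ≤ m) (x : X) : compBelow k n (k m x) = k (m + n) (compBelow k n x) := by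
  induction n generalizing m x with
  | zero => rfl
  | succ n ih =>
    rw [compBelow, Function.comp_apply, Function.comp_apply, hk n m (by lia), ih (by lia)]
    congr 1
    lia

theorem compBelow_compBelow_comm (hk : ∀ i m, i ≤ m → ∀ x, k i (k m x) = k (m + 1) (k i x))
    (n r : ℕ) (x : X) : compBelow k n (compBelow (fun i => k (n + i)) r x) =
      compBelow (fun i => k (2 * n + i)) r (compBelow k n x) := by
  induction r generalizing x with
  | zero => rfl
  | succ r ih =>
    rw [compBelow, Function.comp_apply, ih, compBelow_comm hk (by lia), compBelow,
      Function.comp_apply]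
    congr 2
    lia

end CompBelow

theorem elem_compBelow {k : ℕ → VSet lam → VSet lam} (hk : ∀ n, Elem (k n)) (n : ℕ) :
    Elem (compBelow k n) := by
  induction n with
  | zero => exact fun φ v => Iff.rfl
  | succ n ih => exact ih.comp (hk n)

theorem realize_congr_of_freeVar {L : FirstOrder.Language} {M α : Type*} [L.Structure M]
    [DecidableEq α] {φ : L.Formula α} {v w : α → M} (h : ∀ a ∈ φ.freeVarFinset, v a = w a) :
    φ.Realize v ↔ φ.Realize w := by
  have hvw : v ∘ (Subtype.val : {a // a ∈ (φ.freeVarFinset : Set α)} → α) = w ∘ Subtype.val :=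
    funext fun a => h a.1 a.2
  rw [Formula.Realize, Formula.Realize,
    ← BoundedFormula.realize_restrictFreeVar' (v := v) Set.Subset.rfl,
    ← BoundedFormula.realize_restrictFreeVar' (v := w) Set.Subset.rfl, hvw]

/-- If every finite set of parameters is in the range of one of the elementary maps `T r`, uniformly
for large `r`, then so is everything definable from these parameters. -/
theorem exists_eq_of_mem_defClosure {T : ℕ → VSet lam → VSet lam} (hT : ∀ r, Elem (T r))
    {D : Set (VSet lam)} (hD : ∀ a ∈ D, ∃ x N, ∀ r ≥ N, T r x = a) {b : VSet lam}
    (hb : b ∈ defClosure D) : ∃ r > 0, ∃ x, T r x = b := by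
  classical
  obtain ⟨φ, hφ⟩ := Set.definable_iff_exists_formula_sum.1 hb
  have hφ (v : Fin 1 → VSet lam) : φ.Realize (Sum.elim (↑) v) ↔ v 0 = b :=
    (Set.ext_iff.1 hφ v).symm
  choose! q N hq using hD
  -- Only finitely many parameters occur in `φ`, so one `r` serves all of them; the successor makes
  -- it positive.
  let r := φ.freeVarFinset.sup (Sum.elim (fun a => N a) fun _ => 0) + 1
  let E := (hT r).toElementaryEmbedding
  have hE (a : D) (ha : Sum.inl a ∈ φ.freeVarFinset) : T r (q a) = a := by
    refine hq a a.2 r ?_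
    exact (Finset.le_sup (f := Sum.elim (fun a : D => N a) fun _ => 0) ha).trans (Nat.le_succ _)
  have hcongr (v : Fin 1 → VSet lam) : φ.Realize (Sum.elim (E ∘ fun a : D => q a) v) ↔ v 0 = b := by
    rw [← hφ]
    refine realize_congr_of_freeVar ?_
    rintro (a | i) ha
    · exact hE a ha
    · rfl
  -- Existence of a solution reflects to the preimages of the parameters; the image of a solution
  -- there must be `b`.
  have h₁ : (φ.iExs (Fin 1)).Realize (E ∘ fun a : D => q a) :=
    Formula.realize_iExs.2 ⟨fun _ => b, (hcongr _).2 rfl⟩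
  rw [E.map_formula, Formula.realize_iExs] at h₁
  obtain ⟨x, hx⟩ := h₁
  rw [← E.map_formula, Sum.comp_elim, hcongr] at hx
  exact ⟨r, Nat.succ_pos _, x 0, hx⟩

/-! ### The range of the inverse limit and the omitted intervals -/

section

variable {j : VSet lam → VSet lam} (hlam : Order.IsSuccLimit lam) (hj : ClassElem j)
  (hne : ∃ x, j x ≠ x)
include hlam hj hne

theorem exists_forall_rightPower_eq_self (hcof : ∀ α < lam, ∃ n, α < critSeq j n)
    (a : VSet lam) : ∃ N, ∀ m > N, rightPower j m a = a := by
  obtain ⟨N, hN⟩ := hcof _ (rank_lt a)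
  exact ⟨N, fun m hm => rightPower_eq_self hlam hj hne
    (hN.trans (critSeq_strictMono hlam hj hne hm))⟩

/-- Only the outermost factor moves κ_n; the others have larger index and fix it. At least one
factor is needed, hence `r + 1`. -/
theorem compBelow_rightPower_critSeq (n r : ℕ) :
    compBelow (fun i => rightPower j (n + i)) (r + 1)
      (ordV (critSeq j n) (critSeq_lt hlam hj hne n)) =
        ordV (critSeq j (n + 1)) (critSeq_lt hlam hj hne (n + 1)) := by
  induction r with
  | zero => exact rightPower_critSeq hlam hj hne n
  | succ r ih =>
    rw [compBelow, Function.comp_apply, rightPower_eq_self hlam hj hne, ih]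
    rw [rank_ordV]
    exact critSeq_strictMono hlam hj hne (by lia)

theorem compBelow_rightPower_eq_self {n : ℕ} (r : ℕ) {x : VSet lam}
    (hx : x.1.rank < critSeq j n) : compBelow (fun i => rightPower j (n + i)) r x = x :=
  compBelow_eq_self r fun _ _ => rightPower_eq_self hlam hj hne
    (hx.trans_le ((critSeq_strictMono hlam hj hne).monotone (by lia)))

theorem ordInterval_inter_defClosure (hcof : ∀ α < lam, ∃ n, α < critSeq j n) (n : ℕ) :
    ordInterval lam (critSeq j (2 * n)) (critSeq j (2 * n + 1)) ∩
      defClosure (Set.range (inverseLimit (rightPower j)) ∪ levelSet lam (critSeq j (2 * n))) =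
        ∅ := by
  rw [Set.eq_empty_iff_forall_notMem]
  rintro b ⟨⟨γ, hγ, hγ', hbγ⟩, hb⟩
  let T : ℕ → VSet lam → VSet lam := compBelow fun i => rightPower j (2 * n + i)
  have hD : ∀ a ∈ Set.range (inverseLimit (rightPower j)) ∪ levelSet lam (critSeq j (2 * n)),
      ∃ x N, ∀ r ≥ N, T r x = a := by
    intro a ha
    obtain ⟨c, rfl⟩ | ha := ha
    · obtain ⟨N, hN⟩ := exists_inverseLimit_eq
        (exists_forall_rightPower_eq_self hlam hj hne hcof c)
      refine ⟨compBelow (rightPower j) n c, N, fun r hr => ?_⟩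
      -- k(c) is a composition of n + r factors; moving the first `n` to the right turns the rest
      -- into `T r`, whose argument does not depend on `r`.
      rw [hN (n + r) (by lia), compBelow_add, Function.comp_apply]
      exact (compBelow_compBelow_comm (k := rightPower j)
        (fun i m him => rightPower_comm hlam hj him) n r c).symm
    · exact ⟨a, 0, fun r _ => compBelow_rightPower_eq_self hlam hj hne r
        (ZFSet.mem_vonNeumann.1 ha)⟩
  obtain ⟨r, hr, x, hx⟩ := exists_eq_of_mem_defClosure (T := T)
    (elem_compBelow fun i => elem_rightPower hlam hj _) hD hb
  obtain ⟨r, rfl⟩ : ∃ s, r = s + 1 := ⟨r - 1, by lia⟩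
  have hTκ := compBelow_rightPower_critSeq hlam hj hne (2 * n) r
  -- b = T(x) lies below κ_{2n+1} = T(κ_{2n}), so `x` lies below κ_{2n} and is fixed, contradicting
  -- κ_{2n} ≤ b.
  have hmem : x.1 ∈ (ordV (critSeq j (2 * n)) (critSeq_lt hlam hj hne _)).1 := by
    rw [← (elem_compBelow (fun i => elem_rightPower hlam hj (2 * n + i)) (r + 1)).mem_iff, hTκ]
    change (T (r + 1) x).1 ∈ _
    rw [hx, hbγ]
    exact Ordinal.toZFSet_mem_toZFSet_iff.2 hγ'
  have hrank := ZFSet.rank_lt_of_mem hmem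
  rw [rank_ordV] at hrank
  have hxb : x = b := (compBelow_rightPower_eq_self hlam hj hne (r + 1) hrank).symm.trans hx
  rw [hxb, hbγ, Ordinal.rank_toZFSet] at hrank
  exact hγ.not_gt hrank

end

end RankToRank

/-- The first three conjuncts say that the objects in the claim are well defined: the critical
sequence exists and increases strictly below `λ`, each right power is the function whose graph
is obtained by applying the previous one to itself, and the inverse limit of the right powers is
defined on all of `V_λ`. The fourth one is the claim. -/
theorem proposition19 (lam : Ordinal.{u}) (hlam : Order.IsSuccLimit lam)
    (j : RankToRank.VSet lam ↪ₑ[RankToRank.setLang] RankToRank.VSet lam)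
    (hne : ∃ x, j x ≠ x) (hj : RankToRank.IsSigmaOneOne j) :
    (StrictMono (RankToRank.critSeq j) ∧ ∀ n, RankToRank.critSeq j n < lam) ∧
    (∀ n, RankToRank.graphOf (RankToRank.rightPower j (n + 1)) =
      RankToRank.extend (RankToRank.rightPower j n)
        (RankToRank.graphOf (RankToRank.rightPower j n))) ∧
    (∀ a, ∃ N, ∀ m > N, RankToRank.rightPower j m a = a) ∧
    ∀ n : ℕ,
      RankToRank.ordInterval lam (RankToRank.critSeq j (2 * n))
          (RankToRank.critSeq j (2 * n + 1)) ∩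
        RankToRank.defClosure
          (Set.range (RankToRank.inverseLimit (RankToRank.rightPower j)) ∪
            RankToRank.levelSet lam (RankToRank.critSeq j (2 * n))) = ∅ := by
  have hj' := hj.classElem
  have hcof (α : Ordinal.{u}) (hα : α < lam) : ∃ n, α < RankToRank.critSeq j n :=
    RankToRank.exists_lt_critSeq hlam hj' hne hα
  exact ⟨⟨RankToRank.critSeq_strictMono hlam hj' hne, RankToRank.critSeq_lt hlam hj' hne⟩,
    fun n => (RankToRank.rightPower_spec hlam hj' n).2.1.symm,
    RankToRank.exists_forall_rightPower_eq_self hlam hj' hne hcof,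
    RankToRank.ordInterval_inter_defClosure hlam hj' hne hcof⟩
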